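/- Let $m\ge 1$, let $\Omega\subset\mathbb{R}^2$ be open with $0\in\Omega$, and let $A:\Omega\times\mathbb{R}^{m\times 2}\to\mathbb{R}^{m\times 2}$, $(x,F)\mapsto A(x,F)$, be of class $C^1$. Suppose that there are constants $C,\nu>0$, independent of $x$ and $F$, such that for all $x\in\Omega$ and all $F\in\mathbb{R}^{m\times 2}$: (H1) $|D_FA(x,F)|\le C(1+|F|)$; (H2) $\displaystyle\sum_{i,r=1}^{m}\sum_{j,s=1}^{2}\frac{\partial A_{ij}}{\partial F_{rs}}(x,F)\,a_ib_ja_rb_s\ \ge\ \nu|a|^2|b|^2$ for all $a\in\mathbb{R}^m$ and $b\in\mathbb{R}^2$. For a function $g:\mathbb{S}^1\to\mathbb{R}^m$ on the unit circle of $\mathbb{R}^2$, let $u^g(x)=|x|\,g(x/|x|)$ for $x\neq0$ and $u^g(0)=0$. Assume that $u^g\in W^{1,2}(\Omega;\mathbb{R}^m)$ and that, with $X\cdot Y=\operatorname{tr}(X^TY)$ and $\nabla u^g$ the weak gradient, $$\int_\Omega A(x,\nabla u^g(x))\cdot\nabla\varphi(x)\,dx=0\qquad\text{for all }\varphi\in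 C^1_c(\Omega;\mathbb{R}^m).$$ Then $g\in W^{2,2}(\mathbb{S}^1;\mathbb{R}^m)$, that is, $g$ has weak derivatives $g'$ and $g''$ with respect to arclength on $\mathbb{S}^1$, and $g,g',g''\in L^2(\mathbb{S}^1;\mathbb{R}^m)$. -/

import Mathlib

open MeasureTheory Set
open scoped ContDiff

noncomputable section

namespace OneHom

/-- The plane with its Euclidean norm and Lebesgue measure. -/
abbrev Plane : Type := EuclideanSpace ℝ (Fin 2)

/-- The target space of dimension `m` with its Euclidean norm. -/
abbrev Vec (m : ℕ) : Type := EuclideanSpace ℝ (Fin m)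

/-- Real `m × 2` matrices, with entries `F (i, j)`; the inner product is
`X · Y = ∑ X_ij Y_ij = tr (Xᵀ Y)` and the norm is the associated (Frobenius) one. -/
abbrev Mat (m : ℕ) : Type := EuclideanSpace ℝ (Fin m × Fin 2)

/-- The unit circle in the plane. -/
abbrev S1 : Type := Metric.sphere (0 : Plane) 1

/-- The rank-one matrix `a ⊗ b`, with entries `a_i b_j`. -/
def dyad {m : ℕ} (a : Vec m) (b : Plane) : Mat m :=
  WithLp.toLp 2 fun p => a p.1 * b p.2

/-- The partial derivative in the `j`-th coordinate direction. -/
def partialD {V : Type*} [NormedAddCommGroup V] [NormedSpace ℝ V]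
    (j : Fin 2) (f : Plane → V) (x : Plane) : V :=
  fderiv ℝ f x (EuclideanSpace.single j 1)

/-- The classical gradient matrix, with entries `∂φ_i / ∂x_j`. -/
def gradMat {m : ℕ} (φ : Plane → Vec m) (x : Plane) : Mat m :=
  WithLp.toLp 2 fun p => partialD p.2 φ x p.1

/-- `u ∈ W^{1,2}(Ω; ℝ^m)`, with weak gradient `Du`: both are square integrable on `Ω`, and
`∫ u_i ∂_j ψ = - ∫ (Du)_ij ψ` for all smooth `ψ` with compact support in `Ω`. -/
structure IsW12 {m : ℕ} (Ω : Set Plane) (u : Plane → Vec m) (Du : Plane → Mat m) : Prop where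
  memLp : MemLp u 2 (volume.restrict Ω)
  memLp_grad : MemLp Du 2 (volume.restrict Ω)
  weak_grad : ∀ ψ : Plane → ℝ, ContDiff ℝ ∞ ψ → HasCompactSupport ψ → tsupport ψ ⊆ Ω →
    ∀ (i : Fin m) (j : Fin 2),
      ∫ x in Ω, u x i * partialD j ψ x = - ∫ x in Ω, Du x (i, j) * ψ x

/-- The point of the unit circle with polar angle `θ`. -/
def circ (θ : ℝ) : S1 :=
  ⟨!₂[Real.cos θ, Real.sin θ], by
    simp [EuclideanSpace.norm_eq, Fin.sum_univ_two]⟩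

/-- The radial projection of a nonzero point to the unit circle. -/
def toS1 (x : Plane) (hx : x ≠ 0) : S1 :=
  ⟨‖x‖⁻¹ • x, by
    have h : ‖x‖ ≠ 0 := norm_ne_zero_iff.mpr hx
    simp [norm_smul, h]⟩

open Classical in
/-- The one-homogeneous map `u^g(x) = |x| g(x / |x|)`, with `u^g(0) = 0`. -/
def oneHom {m : ℕ} (g : S1 → Vec m) (x : Plane) : Vec m :=
  if hx : x = 0 then 0 else ‖x‖ • g (toS1 x hx)

/-- `g₁` is the weak (arclength) derivative of `g` on the unit circle; smooth test functions on
the circle are smooth `2π`-periodic functions of the polar angle. -/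
def IsWeakDerivS1 {m : ℕ} (g g₁ : S1 → Vec m) : Prop :=
  ∀ ψ : ℝ → ℝ, ContDiff ℝ ∞ ψ → Function.Periodic ψ (2 * Real.pi) →
    ∫ θ in Ioc 0 (2 * Real.pi), deriv ψ θ • g (circ θ)
      = - ∫ θ in Ioc 0 (2 * Real.pi), ψ θ • g₁ (circ θ)

/-- Square integrability on the unit circle with respect to arclength. -/
def MemL2S1 {m : ℕ} (g : S1 → Vec m) : Prop :=
  MemLp (fun θ => g (circ θ)) 2 (volume.restrict (Ioc 0 (2 * Real.pi)))

/-- `g ∈ W^{2,2}(S¹; ℝ^m)`: `g` and its first two weak derivatives are square integrable. -/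
def MemW22S1 {m : ℕ} (g : S1 → Vec m) : Prop :=
  ∃ g₁ g₂ : S1 → Vec m, MemL2S1 g ∧ MemL2S1 g₁ ∧ MemL2S1 g₂ ∧
    IsWeakDerivS1 g g₁ ∧ IsWeakDerivS1 g₁ g₂

end OneHom

end

/-!
In polar coordinates the gradient of `u^g` is zero-homogeneous: it equals
`G(θ) = g(θ) ⊗ e_r + g'(θ) ⊗ e_θ`. This is proved for the weak gradient by testing with the fields
`ψ(x) x` (Euler's identity, `IsLocalGrad.ae_mulV_self`) and `ψ(x) x^⊥`
(`IsLocalGrad.ae_mulV_rot`), the weak derivative `h = g'` being obtained as a radial average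
(`IsLocalGrad.exists_weakDeriv`). Square integrability of the gradient on a ball gives `G ∈ L²`.

Since `A(x, F)` grows at most quadratically in `F`, the equation may be tested with
`η(|x| / ε) χ(arg x)` and blown up: as `ε → 0` only `a = A(0, ·)` survives, and the equation becomes
the ordinary differential equation `(a(G) e_θ)' = - a(G) e_r` on the circle, in the weak sense
(`weakDerivPer_of_divergence_free`). Its right-hand side is only in `L¹`, but this makes `a(G) e_θ`
bounded (`WeakDerivPer.exists_ae_bound`), as is `g`.

Integrating the rank-one ellipticity along rank-one segments (`rankOne_monotone`) shows that
`p ↦ a(F + p ⊗ e_θ) e_θ` is strongly monotone, with constant `ν`. Hence `g'` is controlled by `g`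
and `a(G) e_θ`, first in `L^∞`. Then `G` is bounded, so `g` and `a(G) e_θ` are Lipschitz, and
monotonicity once more shows that `g'` is Lipschitz (`exists_lipschitz_derivative`). A Lipschitz
function has a bounded weak derivative, so `g` even lies in `W^{2,∞}`.
-/

noncomputable section

namespace OneHom


/-! ### Polar coordinates on the Euclidean plane -/

section

/-- The radial unit vector `e_r` at polar angle `θ`. -/
def er (θ : ℝ) : Plane := !₂[Real.cos θ, Real.sin θ]

/-- The tangential unit vector `e_θ` at polar angle `θ`. -/
def et (θ : ℝ) : Plane := !₂[-Real.sin θ, Real.cos θ]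

/-- Polar coordinates `(r, θ) ↦ r e_r(θ)`. -/
def polar (p : ℝ × ℝ) : Plane := p.1 • er p.2

/-- The polar angle of a point, in `(-π, π]`. -/
def angle (x : Plane) : ℝ := Complex.arg ⟨x 0, x 1⟩

/-- Lebesgue measure on the parameter domain `(0, ∞) × (0, 2π]` of polar coordinates. -/
def polarDom : Measure (ℝ × ℝ) :=
  (volume.restrict (Ioi 0)).prod (volume.restrict (Ioc 0 (2 * Real.pi)))

instance : SFinite polarDom := by unfold polarDom; infer_instance

@[simp] lemma er_zero (θ : ℝ) : er θ 0 = Real.cos θ := rfl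
@[simp] lemma er_one (θ : ℝ) : er θ 1 = Real.sin θ := rfl
@[simp] lemma et_zero (θ : ℝ) : et θ 0 = -Real.sin θ := rfl
@[simp] lemma et_one (θ : ℝ) : et θ 1 = Real.cos θ := rfl

lemma circ_coe (θ : ℝ) : (circ θ : Plane) = er θ := rfl

lemma hasDerivAt_er (θ : ℝ) : HasDerivAt er (et θ) θ := by
  have h : HasDerivAt (fun θ => ![Real.cos θ, Real.sin θ]) ![-Real.sin θ, Real.cos θ] θ := by
    rw [hasDerivAt_pi]
    intro i
    fin_cases i
    · simpa using Real.hasDerivAt_cos θ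
    · simpa using Real.hasDerivAt_sin θ
  exact (PiLp.continuousLinearEquiv 2 ℝ (fun _ : Fin 2 => ℝ)).symm.hasFDerivAt.comp_hasDerivAt θ h

lemma hasDerivAt_et (θ : ℝ) : HasDerivAt et (-er θ) θ := by
  have h : HasDerivAt (fun θ => ![-Real.sin θ, Real.cos θ]) ![-Real.cos θ, -Real.sin θ] θ := by
    rw [hasDerivAt_pi]
    intro i
    fin_cases i
    · exact (Real.hasDerivAt_sin θ).fun_neg
    · simpa using Real.hasDerivAt_cos θ
  have := (PiLp.continuousLinearEquiv 2 ℝ (fun _ : Fin 2 => ℝ)).symm.hasFDerivAt.comp_hasDerivAt θ h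
  convert! this using 1
  ext i
  fin_cases i <;> simp

lemma norm_er (θ : ℝ) : ‖er θ‖ = 1 := by
  simp [EuclideanSpace.norm_eq, Fin.sum_univ_two]

lemma norm_et (θ : ℝ) : ‖et θ‖ = 1 := by
  simp [EuclideanSpace.norm_eq, Fin.sum_univ_two]

lemma er_add_pi (θ : ℝ) : er (θ + Real.pi) = -er θ := by
  ext i; fin_cases i <;> simp

lemma er_periodic : Function.Periodic er (2 * Real.pi) := fun θ => by
  ext i; fin_cases i <;> simp

lemma et_periodic : Function.Periodic et (2 * Real.pi) := fun θ => by
  ext i; fin_cases i <;> simp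

lemma circ_periodic : Function.Periodic circ (2 * Real.pi) := fun θ =>
  Subtype.ext (er_periodic θ)

lemma contDiff_er : ContDiff ℝ ∞ er := by
  unfold er
  rw [contDiff_euclidean]
  intro i
  fin_cases i
  · exact Real.contDiff_cos
  · exact Real.contDiff_sin

lemma contDiff_polar : ContDiff ℝ ∞ polar := by
  unfold polar
  exact contDiff_fst.smul (contDiff_er.comp contDiff_snd)

lemma continuous_polar : Continuous polar := contDiff_polar.continuous

lemma continuous_er : Continuous er := contDiff_er.continuous

lemma continuous_et : Continuous et :=
  continuous_iff_continuousAt.2 fun θ => (hasDerivAt_et θ).continuousAt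

lemma norm_polar {p : ℝ × ℝ} (hp : 0 ≤ p.1) : ‖polar p‖ = p.1 := by
  simp [polar, norm_smul, norm_er, abs_of_nonneg hp]

lemma polar_ne_zero {p : ℝ × ℝ} (hp : 0 < p.1) : polar p ≠ 0 := by
  rw [← norm_pos_iff, norm_polar hp.le]; exact hp

/-- The one-homogeneous map in polar coordinates. -/
lemma oneHom_polar {m : ℕ} (g : S1 → Vec m) {p : ℝ × ℝ} (hp : 0 < p.1) :
    oneHom g (polar p) = p.1 • g (circ p.2) := by
  have h0 := polar_ne_zero hp
  rw [oneHom, dif_neg h0, norm_polar hp.le]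
  congr 2
  apply Subtype.ext
  simp only [toS1, norm_polar hp.le, circ_coe]
  rw [polar, smul_smul, inv_mul_cancel₀ hp.ne', one_smul]

lemma measurable_angle : Measurable angle := by
  unfold angle
  apply Complex.measurable_arg.comp
  have : (fun x : Plane => (⟨x 0, x 1⟩ : ℂ)) = fun x => Complex.equivRealProd.symm (x 0, x 1) := rfl
  rw [this]
  apply Continuous.measurable
  exact Complex.equivRealProdCLM.symm.continuous.comp (by fun_prop)

/-- `angle` and the parameter `θ` agree modulo `2π`, so a periodic function does not see the
difference. -/
lemma angle_polar {p : ℝ × ℝ} (hp : 0 < p.1) {α : Type*} {f : ℝ → α}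
    (hf : Function.Periodic f (2 * Real.pi)) : f (angle (polar p)) = f p.2 := by
  have h : angle (polar p) = toIocMod Real.two_pi_pos (-Real.pi) p.2 := by
    rw [← Complex.arg_mul_cos_add_sin_mul_I_eq_toIocMod hp p.2]
    unfold angle
    congr 1
    apply Complex.ext <;> simp [polar, Complex.cos_ofReal_re, Complex.sin_ofReal_re]
  rw [h, toIocMod]
  exact hf.sub_zsmul_eq _

lemma polar_angle (x : Plane) : polar (‖x‖, angle x) = x := by
  have h := Complex.norm_mul_cos_add_sin_mul_I (⟨x 0, x 1⟩ : ℂ)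
  have hn : ‖(⟨x 0, x 1⟩ : ℂ)‖ = ‖x‖ := by
    rw [Complex.norm_eq_sqrt_sq_add_sq, EuclideanSpace.norm_eq, Fin.sum_univ_two]
    simp
  rw [hn] at h
  have h1 := congrArg Complex.re h
  have h2 := congrArg Complex.im h
  simp at h1 h2
  ext i
  fin_cases i
  · simpa [polar, angle, Complex.cos_ofReal_re] using h1
  · simpa [polar, angle, Complex.sin_ofReal_re] using h2

/-- Integration in polar coordinates, with angles in `(0, 2π]` instead of Mathlib's `(-π, π)`. -/
lemma lintegral_polar (f : Plane → ENNReal) (hf : Measurable f) :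
    ∫⁻ p, ENNReal.ofReal p.1 * f (polar p) ∂polarDom = ∫⁻ x, f x := by
  have e1 := EuclideanSpace.volume_preserving_symm_measurableEquiv_toLp (Fin 2)
  have e2 := (volume_preserving_finTwoArrow ℝ)
  have e := e2.comp e1
  -- the rotation by `π` moves the angular interval `(-π, π)` to `(0, 2π)`
  have h1 : ∫⁻ x, f x = ∫⁻ z : ℝ × ℝ, f (-!₂[z.1, z.2]) := by
    rw [← lintegral_neg_eq_self, ← e.lintegral_comp]
    · congr 1
      ext x
      congr 2
      ext i
      fin_cases i <;> rfl
    · apply hf.comp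
      apply Continuous.measurable
      fun_prop
  have hm : Measurable fun p : ℝ × ℝ => ENNReal.ofReal p.1 * f (polar p) :=
    (ENNReal.measurable_ofReal.comp measurable_fst).mul (hf.comp continuous_polar.measurable)
  have hm' : Measurable fun p : ℝ × ℝ => ENNReal.ofReal p.1 * f (polar (p.1, p.2 + Real.pi)) :=
    (ENNReal.measurable_ofReal.comp measurable_fst).mul
      (hf.comp (continuous_polar.measurable.comp (by fun_prop)))
  rw [h1, ← _root_.lintegral_comp_polarCoord_symm]
  have h2 : ∀ p : ℝ × ℝ, ENNReal.ofReal p.1 •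
      (fun z : ℝ × ℝ => f (-!₂[z.1, z.2])) (polarCoord.symm p)
      = ENNReal.ofReal p.1 * f (polar (p.1, p.2 + Real.pi)) := by
    intro p
    simp only [smul_eq_mul]
    congr 2
    rw [polar, er_add_pi]
    ext i
    fin_cases i <;> simp
  simp_rw [h2]
  rw [polarCoord_target, Measure.volume_eq_prod, ← Measure.prod_restrict, polarDom,
    lintegral_prod _ hm.aemeasurable, lintegral_prod _ hm'.aemeasurable]
  congr 1
  ext r
  have h3 : ∀ F : ℝ → ENNReal, ∫⁻ θ in Ioc 0 (2 * Real.pi), F θ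
      = ∫⁻ θ in Ioo (-Real.pi) Real.pi, F (θ + Real.pi) := by
    intro F
    rw [restrict_Ioo_eq_restrict_Ioc,
      ← (measurePreserving_add_right volume Real.pi).setLIntegral_comp_preimage_emb
        (measurableEmbedding_addRight Real.pi)]
    congr 2
    ext x
    simp only [mem_preimage, mem_Ioc]
    constructor <;> rintro ⟨h, h'⟩ <;> constructor <;> linarith
  exact h3 fun θ => ENNReal.ofReal r * f (polar (r, θ))

/-- Polar coordinates carry `r dr dθ` to Lebesgue measure; null sets and integrals are transferred
through this fact. -/
lemma measurePreserving_polar :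
    MeasurePreserving polar (polarDom.withDensity fun p => ENNReal.ofReal p.1) volume := by
  refine ⟨continuous_polar.measurable, ?_⟩
  refine Measure.ext_of_lintegral _ fun f hf => ?_
  rw [lintegral_map hf continuous_polar.measurable, ← lintegral_polar f hf]
  exact lintegral_withDensity_eq_lintegral_mul _ (by fun_prop)
    (hf.comp continuous_polar.measurable)

lemma ae_polarDom_pos : ∀ᵐ p ∂polarDom, 0 < p.1 :=
  Measure.quasiMeasurePreserving_fst.ae (ae_restrict_mem measurableSet_Ioi)

lemma polarDom_absolutelyContinuous :
    polarDom ≪ polarDom.withDensity fun p => ENNReal.ofReal p.1 := by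
  apply withDensity_absolutelyContinuous' (by fun_prop)
  filter_upwards [ae_polarDom_pos] with p hp
  simpa using hp

lemma quasiMeasurePreserving_polar : Measure.QuasiMeasurePreserving polar polarDom volume :=
  measurePreserving_polar.quasiMeasurePreserving.mono_left polarDom_absolutelyContinuous

variable {E : Type*} [NormedAddCommGroup E] [NormedSpace ℝ E]

lemma integrable_polar {f : Plane → E} (hf : Integrable f) :
    Integrable (fun p => p.1 • f (polar p)) polarDom := by
  have h := measurePreserving_polar.integrable_comp_of_integrable hf
  rw [integrable_withDensity_iff_integrable_smul' (by fun_prop) (by simp)] at h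
  refine h.congr ?_
  filter_upwards [ae_polarDom_pos] with p hp
  simp [ENNReal.toReal_ofReal hp.le]

lemma integrable_of_polar {f : Plane → E} (hf : AEStronglyMeasurable f)
    (h : Integrable (fun p => p.1 • f (polar p)) polarDom) : Integrable f := by
  rw [← measurePreserving_polar.map_eq] at hf ⊢
  rw [integrable_map_measure hf continuous_polar.aemeasurable,
    integrable_withDensity_iff_integrable_smul' (by fun_prop) (by simp)]
  refine h.congr ?_
  filter_upwards [ae_polarDom_pos] with p hp
  simp [ENNReal.toReal_ofReal hp.le]

lemma integral_polar {f : Plane → E} (hf : AEStronglyMeasurable f) :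
    ∫ x, f x = ∫ p, p.1 • f (polar p) ∂polarDom := by
  rw [← measurePreserving_polar.map_eq] at hf ⊢
  rw [integral_map continuous_polar.aemeasurable hf,
    integral_withDensity_eq_integral_toReal_smul (by fun_prop) (by simp)]
  apply integral_congr_ae
  filter_upwards [ae_polarDom_pos] with p hp
  simp [ENNReal.toReal_ofReal hp.le]

end

/-! ### Test functions separating the polar variables -/

section

variable {E : Type*} [NormedAddCommGroup E] [NormedSpace ℝ E] {m : ℕ}

lemma angle_neg_add_pi {α : Type*} {f : ℝ → α} (hf : Function.Periodic f (2 * Real.pi))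
    {x : Plane} (hx : x ≠ 0) : f (angle (-x) + Real.pi) = f (angle x) := by
  have h : -x = polar (‖x‖, angle x + Real.pi) := by
    conv_lhs => rw [← polar_angle x]
    simp [polar, er_add_pi]
  have hF : Function.Periodic (fun t => f (t + Real.pi)) (2 * Real.pi) := fun t => by
    simp only
    rw [add_right_comm, hf]
  have := angle_polar (p := (‖x‖, angle x + Real.pi)) (norm_pos_iff.2 hx) hF
  rw [h]
  simp only at this
  rw [this, add_assoc, ← two_mul, hf]

lemma contDiffAt_angle {x : Plane} (hx : (⟨x 0, x 1⟩ : ℂ) ∈ Complex.slitPlane) :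
    ContDiffAt ℝ ∞ angle x := by
  have h1 : ContDiffAt ℝ ∞ (fun y : Plane => Complex.equivRealProdCLM.symm (y 0, y 1)) x := by
    apply Complex.equivRealProdCLM.symm.contDiff.contDiffAt.comp
    fun_prop
  have h2 : ContDiffAt ℝ ∞ Complex.log (Complex.equivRealProdCLM.symm (x 0, x 1)) :=
    (Complex.contDiffAt_log (n := ∞) hx).restrict_scalars ℝ
  have h3 := Complex.imCLM.contDiff.contDiffAt.comp x (h2.comp x h1)
  refine h3.congr_of_eventuallyEq (Filter.Eventually.of_forall fun y => ?_)
  simp only [angle, Function.comp, Complex.imCLM_apply, Complex.log_im]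
  rfl

/-- A smooth periodic function of the polar angle is smooth away from the origin: across the
branch cut of the angle, use the angle of `-x` instead. -/
lemma contDiffAt_comp_angle {f : ℝ → E} (hf : ContDiff ℝ ∞ f)
    (hper : Function.Periodic f (2 * Real.pi)) {x : Plane} (hx : x ≠ 0) :
    ContDiffAt ℝ ∞ (fun y => f (angle y)) x := by
  have hz : (⟨x 0, x 1⟩ : ℂ) ≠ 0 := by
    intro h
    apply hx
    ext i
    fin_cases i
    · exact congrArg Complex.re h
    · exact congrArg Complex.im h
  by_cases h : (⟨x 0, x 1⟩ : ℂ) ∈ Complex.slitPlane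
  · exact hf.contDiffAt.comp x (contDiffAt_angle h)
  · have h' : (⟨(-x) 0, (-x) 1⟩ : ℂ) ∈ Complex.slitPlane := by
      rw [Complex.mem_slitPlane_iff] at h ⊢
      push Not at h
      left
      rcases h.1.lt_or_eq with h1 | h1
      · simpa using h1
      · exact absurd (Complex.ext h1 h.2) hz
    have h1 : ContDiffAt ℝ ∞ (fun y : Plane => f (angle (-y) + Real.pi)) x := by
      apply hf.contDiffAt.comp
      exact ((contDiffAt_angle h').comp x contDiff_neg.contDiffAt).add contDiffAt_const
    refine h1.congr_of_eventuallyEq ?_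
    filter_upwards [isOpen_ne.mem_nhds hx] with y hy
    exact (angle_neg_add_pi hper hy).symm

/-- The function `η(|x|) χ(arg x)` separating the polar variables. -/
def sep (η χ : ℝ → ℝ) (x : Plane) : ℝ := η ‖x‖ * χ (angle x)

lemma sep_polar {η χ : ℝ → ℝ} (hχ : Function.Periodic χ (2 * Real.pi)) {p : ℝ × ℝ}
    (hp : 0 < p.1) : sep η χ (polar p) = η p.1 * χ p.2 := by
  rw [sep, norm_polar hp.le, angle_polar hp hχ]

lemma contDiff_sep {η χ : ℝ → ℝ} (hη : ContDiff ℝ ∞ η) (hη0 : tsupport η ⊆ Ioi 0)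
    (hχ : ContDiff ℝ ∞ χ) (hper : Function.Periodic χ (2 * Real.pi)) :
    ContDiff ℝ ∞ (sep η χ) := by
  rw [contDiff_iff_contDiffAt]
  intro x
  by_cases hx : x = 0
  · have h0 : (0 : ℝ) ∉ tsupport η := fun h => lt_irrefl (0 : ℝ) (hη0 h)
    rw [notMem_tsupport_iff_eventuallyEq] at h0
    have : (fun x : Plane => sep η χ x) =ᶠ[nhds x] fun _ => 0 := by
      have ht : Filter.Tendsto (fun x : Plane => ‖x‖) (nhds x) (nhds 0) := by
        have := (continuous_norm (E := Plane)).tendsto x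
        simpa [hx] using this
      filter_upwards [ht.eventually h0] with y hy
      simp [sep, hy]
    exact contDiffAt_const.congr_of_eventuallyEq this
  · exact (hη.contDiffAt.comp x (contDiffAt_norm ℝ hx)).mul (contDiffAt_comp_angle hχ hper hx)

lemma tsupport_sep_subset (η χ : ℝ → ℝ) :
    tsupport (sep η χ) ⊆ {x | ‖x‖ ∈ tsupport η} := by
  apply closure_minimal
  · intro x hx
    apply subset_tsupport
    intro h
    apply hx
    simp [sep, h]
  · exact (isClosed_tsupport η).preimage continuous_norm

lemma hasCompactSupport_sep {η : ℝ → ℝ} (χ : ℝ → ℝ) (hη : HasCompactSupport η) :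
    HasCompactSupport (sep η χ) := by
  obtain ⟨R, hR⟩ := hη.isCompact.isBounded.subset_closedBall 0
  refine HasCompactSupport.intro (isCompact_closedBall (0 : Plane) R) fun x hx => ?_
  have : ‖x‖ ∉ tsupport η := fun h => hx (by simpa using hR h)
  simp [sep, image_eq_zero_of_notMem_tsupport this]

lemma hasDerivAt_polar_fst (r θ : ℝ) : HasDerivAt (fun r => polar (r, θ)) (er θ) r := by
  simpa [polar] using (hasDerivAt_id r).smul_const (er θ)

lemma hasDerivAt_polar_snd (r θ : ℝ) : HasDerivAt (fun θ => polar (r, θ)) (r • et θ) θ := by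
  exact (hasDerivAt_er θ).const_smul r

lemma hasDerivAt_comp_polar_fst {f : Plane → E} {r θ : ℝ}
    (hf : DifferentiableAt ℝ f (polar (r, θ))) :
    HasDerivAt (fun r => f (polar (r, θ))) (fderiv ℝ f (polar (r, θ)) (er θ)) r :=
  hf.hasFDerivAt.comp_hasDerivAt r (hasDerivAt_polar_fst r θ)

lemma hasDerivAt_comp_polar_snd {f : Plane → E} {r θ : ℝ}
    (hf : DifferentiableAt ℝ f (polar (r, θ))) :
    HasDerivAt (fun θ => f (polar (r, θ))) (r • fderiv ℝ f (polar (r, θ)) (et θ)) θ := by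
  have := hf.hasFDerivAt.comp_hasDerivAt θ (hasDerivAt_polar_snd r θ)
  rw [map_smul] at this
  exact this

lemma fderiv_sep_er {η χ : ℝ → ℝ} (hη : ContDiff ℝ ∞ η) (hη0 : tsupport η ⊆ Ioi 0)
    (hχ : ContDiff ℝ ∞ χ) (hper : Function.Periodic χ (2 * Real.pi)) {p : ℝ × ℝ} (hp : 0 < p.1) :
    fderiv ℝ (sep η χ) (polar p) (er p.2) = deriv η p.1 * χ p.2 := by
  have h1 := hasDerivAt_comp_polar_fst (r := p.1) (θ := p.2)
    (((contDiff_sep hη hη0 hχ hper).differentiable (by simp)) _)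
  have h2 : HasDerivAt (fun r => η r * χ p.2) (deriv η p.1 * χ p.2) p.1 :=
    ((hη.differentiable (by simp)) p.1).hasDerivAt.mul_const _
  refine h1.unique (h2.congr_of_eventuallyEq ?_)
  filter_upwards [isOpen_Ioi.mem_nhds hp] with r hr
  exact sep_polar hper hr

lemma fderiv_sep_et {η χ : ℝ → ℝ} (hη : ContDiff ℝ ∞ η) (hη0 : tsupport η ⊆ Ioi 0)
    (hχ : ContDiff ℝ ∞ χ) (hper : Function.Periodic χ (2 * Real.pi)) {p : ℝ × ℝ} (hp : 0 < p.1) :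
    p.1 * fderiv ℝ (sep η χ) (polar p) (et p.2) = η p.1 * deriv χ p.2 := by
  have h1 := hasDerivAt_comp_polar_snd (r := p.1) (θ := p.2)
    (((contDiff_sep hη hη0 hχ hper).differentiable (by simp)) _)
  have h2 : HasDerivAt (fun θ => η p.1 * χ θ) (η p.1 * deriv χ p.2) p.2 :=
    ((hχ.differentiable (by simp)) p.2).hasDerivAt.const_mul _
  refine h1.unique (h2.congr_of_eventuallyEq (Filter.Eventually.of_forall fun θ => ?_))
  exact sep_polar (p := (p.1, θ)) hper hp

/-! ### Gradients in polar coordinates -/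

/-- The product `F b` of a matrix and a vector of the plane. -/
def mulV (F : Mat m) (b : Plane) : Vec m := WithLp.toLp 2 fun i => ∑ j, F (i, j) * b j

/-- The classical gradient of a scalar function. -/
def gradV (ψ : Plane → ℝ) (x : Plane) : Plane := WithLp.toLp 2 fun j => partialD j ψ x

@[simp] lemma mulV_apply (F : Mat m) (b : Plane) (i : Fin m) :
    mulV F b i = F (i, 0) * b 0 + F (i, 1) * b 1 := by simp [mulV, Fin.sum_univ_two]

@[simp] lemma dyad_apply (a : Vec m) (b : Plane) (p : Fin m × Fin 2) :
    dyad a b p = a p.1 * b p.2 := rfl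

@[simp] lemma gradV_apply (ψ : Plane → ℝ) (x : Plane) (j : Fin 2) :
    gradV ψ x j = partialD j ψ x := rfl

lemma inner_dyad (F : Mat m) (a : Vec m) (b : Plane) :
    inner ℝ F (dyad a b) = inner ℝ (mulV F b) a := by
  simp only [PiLp.inner_apply, Fintype.sum_prod_type, Fin.sum_univ_two, dyad_apply, mulV_apply,
    RCLike.inner_apply, conj_trivial]
  refine Finset.sum_congr rfl fun i _ => ?_
  ring

lemma mulV_dyad (a : Vec m) (b c : Plane) : mulV (dyad a b) c = inner ℝ b c • a := by
  ext i
  simp [PiLp.inner_apply, Fin.sum_univ_two]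
  ring

lemma norm_dyad (a : Vec m) (b : Plane) : ‖dyad a b‖ = ‖a‖ * ‖b‖ := by
  have h : ‖dyad a b‖ ^ 2 = (‖a‖ * ‖b‖) ^ 2 := by
    rw [← real_inner_self_eq_norm_sq, inner_dyad, mulV_dyad, inner_smul_left,
      real_inner_self_eq_norm_sq, real_inner_self_eq_norm_sq]
    simp
    ring
  exact (pow_left_inj₀ (norm_nonneg _) (by positivity) two_ne_zero).1 h

lemma norm_mulV_le (F : Mat m) (b : Plane) : ‖mulV F b‖ ≤ ‖F‖ * ‖b‖ := by
  have h : ‖mulV F b‖ * ‖mulV F b‖ ≤ (‖F‖ * ‖b‖) * ‖mulV F b‖ := by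
    rw [← real_inner_self_eq_norm_mul_norm, ← inner_dyad]
    refine (real_inner_le_norm _ _).trans ?_
    rw [norm_dyad]
    apply le_of_eq
    ring
  rcases (norm_nonneg (mulV F b)).eq_or_lt with h0 | h0
  · rw [← h0]; positivity
  · exact le_of_mul_le_mul_right h h0

lemma mulV_sub (F G : Mat m) (b : Plane) : mulV (F - G) b = mulV F b - mulV G b := by
  ext i; simp; ring

lemma mulV_add_right (F : Mat m) (b c : Plane) : mulV F (b + c) = mulV F b + mulV F c := by
  ext i; simp; ring

lemma mulV_sub_right (F : Mat m) (b c : Plane) : mulV F (b - c) = mulV F b - mulV F c := by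
  ext i; simp; ring

lemma mulV_smul_right (F : Mat m) (t : ℝ) (b : Plane) : mulV F (t • b) = t • mulV F b := by
  ext i; simp; ring

lemma dyad_sub_left (a a' : Vec m) (b : Plane) : dyad (a - a') b = dyad a b - dyad a' b := by
  ext i; simp; ring

lemma dyad_sub_right (a : Vec m) (b b' : Plane) : dyad a (b - b') = dyad a b - dyad a b' := by
  ext i; simp; ring

@[fun_prop] lemma continuous_mulV : Continuous fun q : Mat m × Plane => mulV q.1 q.2 := by
  unfold mulV; fun_prop

@[fun_prop] lemma continuous_dyad : Continuous fun q : Vec m × Plane => dyad q.1 q.2 := by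
  unfold dyad; fun_prop

lemma eq_dyad_add_dyad (F : Mat m) (θ : ℝ) :
    F = dyad (mulV F (er θ)) (er θ) + dyad (mulV F (et θ)) (et θ) := by
  ext ⟨i, j⟩
  have h := Real.sin_sq_add_cos_sq θ
  fin_cases j
  · simp
    linear_combination (-F (i, 0)) * h
  · simp
    linear_combination (-F (i, 1)) * h

lemma fderiv_apply_eq (ψ : Plane → ℝ) (x b : Plane) :
    fderiv ℝ ψ x b = b 0 * partialD 0 ψ x + b 1 * partialD 1 ψ x := by
  have : b = b 0 • EuclideanSpace.single 0 1 + b 1 • EuclideanSpace.single 1 1 := by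
    ext i; fin_cases i <;> simp
  conv_lhs => rw [this]
  simp [partialD]

lemma gradV_eq (ψ : Plane → ℝ) (x : Plane) (θ : ℝ) :
    gradV ψ x = fderiv ℝ ψ x (er θ) • er θ + fderiv ℝ ψ x (et θ) • et θ := by
  ext j
  have h := Real.sin_sq_add_cos_sq θ
  rw [fderiv_apply_eq, fderiv_apply_eq]
  fin_cases j
  · simp
    linear_combination (-partialD 0 ψ x) * h
  · simp
    linear_combination (-partialD 1 ψ x) * h

lemma mulV_gradV (F : Mat m) (ψ : Plane → ℝ) (x : Plane) (θ : ℝ) :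
    mulV F (gradV ψ x) =
      fderiv ℝ ψ x (er θ) • mulV F (er θ) + fderiv ℝ ψ x (et θ) • mulV F (et θ) := by
  rw [gradV_eq ψ x θ, mulV_add_right, mulV_smul_right, mulV_smul_right]

lemma gradMat_smul_const {ψ : Plane → ℝ} {x : Plane} (hψ : DifferentiableAt ℝ ψ x) (v : Vec m) :
    gradMat (fun y => ψ y • v) x = dyad v (gradV ψ x) := by
  ext ⟨i, j⟩
  simp [gradMat, partialD, fderiv_smul_const hψ, mul_comm]

lemma continuous_gradV {ψ : Plane → ℝ} (hψ : ContDiff ℝ 1 ψ) : Continuous (gradV ψ) := by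
  have := hψ.continuous_fderiv (by simp)
  unfold gradV partialD
  fun_prop

end

/-! ### Weak derivatives of periodic functions -/

section

variable {E : Type*} [NormedAddCommGroup E] [NormedSpace ℝ E] {m : ℕ}

/-- A `2π`-periodic property holding almost everywhere on one period holds almost everywhere. -/
lemma ae_of_periodic {p : ℝ → Prop} (hp : ∀ θ, p (θ + 2 * Real.pi) ↔ p θ)
    (h : ∀ᵐ θ ∂volume.restrict (Ioc 0 (2 * Real.pi)), p θ) : ∀ᵐ θ : ℝ, p θ := by
  rw [ae_restrict_iff' measurableSet_Ioc] at h
  have hper : Function.Periodic p (2 * Real.pi) := fun θ => propext (hp θ)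
  have h2 : ∀ᵐ θ : ℝ, ∀ n : ℤ, θ + n • (2 * Real.pi) ∈ Ioc 0 (2 * Real.pi) →
      p (θ + n • (2 * Real.pi)) :=
    ae_all_iff.2 fun n =>
      (measurePreserving_add_right volume (n • (2 * Real.pi))).quasiMeasurePreserving.ae h
  filter_upwards [h2] with θ hθ
  obtain ⟨n, hn, -⟩ := existsUnique_add_zsmul_mem_Ioc Real.two_pi_pos θ 0
  have h3 := hθ n (by simpa using hn)
  rwa [hper.zsmul n θ] at h3

/-- The periodic extension of a function supported inside one period is smooth. -/
lemma contDiff_comp_toIocMod {χ : ℝ → ℝ} (hχ : ContDiff ℝ ∞ χ)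
    (hs : tsupport χ ⊆ Ioo 0 (2 * Real.pi)) :
    ContDiff ℝ ∞ fun θ => χ (toIocMod Real.two_pi_pos 0 θ) := by
  rw [contDiff_iff_contDiffAt]
  intro θ
  set k := toIocDiv Real.two_pi_pos 0 θ with hk
  have hmem := sub_toIocDiv_zsmul_mem_Ioc Real.two_pi_pos 0 θ
  rw [← hk, zero_add] at hmem
  -- at a multiple of `2π` the extension vanishes nearby, elsewhere it is locally a translate of `χ`
  rcases hmem.2.lt_or_eq with h | h
  · have h1 : ContDiffAt ℝ ∞ (fun t => χ (t - k • (2 * Real.pi))) θ := by fun_prop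
    refine h1.congr_of_eventuallyEq ?_
    have h2 : ∀ᶠ t in nhds θ, t - k • (2 * Real.pi) ∈ Ioo 0 (2 * Real.pi) := by
      have : ContinuousAt (fun t : ℝ => t - k • (2 * Real.pi)) θ := by fun_prop
      exact this.eventually (isOpen_Ioo.mem_nhds ⟨hmem.1, h⟩)
    filter_upwards [h2] with t ht
    rw [toIocMod, toIocDiv_eq_of_sub_zsmul_mem_Ioc Real.two_pi_pos (n := k)]
    rw [zero_add]
    exact ⟨ht.1, ht.2.le⟩
  · have h0 : (0 : ℝ) ∉ tsupport χ := fun h => lt_irrefl (0 : ℝ) (hs h).1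
    have hT : 2 * Real.pi ∉ tsupport χ := fun h => lt_irrefl (2 * Real.pi) (hs h).2
    rw [notMem_tsupport_iff_eventuallyEq] at h0 hT
    have c1 : Filter.Tendsto (fun t : ℝ => t - k • (2 * Real.pi)) (nhds θ)
        (nhds (2 * Real.pi)) := by
      have := (by fun_prop : Continuous fun t : ℝ => t - k • (2 * Real.pi)).tendsto θ
      rwa [h] at this
    have c2 : Filter.Tendsto (fun t : ℝ => t - (k + 1) • (2 * Real.pi)) (nhds θ) (nhds 0) := by
      have h' : θ - (k + 1) • (2 * Real.pi) = 0 := by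
        rw [add_smul, one_smul]; linarith
      rw [← h']
      exact (by fun_prop : Continuous fun t : ℝ => t - (k + 1) • (2 * Real.pi)).tendsto θ
    have : (fun t => χ (toIocMod Real.two_pi_pos 0 t)) =ᶠ[nhds θ] fun _ => 0 := by
      filter_upwards [c1.eventually hT, c2.eventually h0,
        c1.eventually (isOpen_Ioo.mem_nhds
          (⟨Real.two_pi_pos, by linarith [Real.two_pi_pos]⟩ :
            2 * Real.pi ∈ Ioo 0 (2 * Real.pi + 2 * Real.pi)))] with t h1 h2 h3
      by_cases ht : t - k • (2 * Real.pi) ≤ 2 * Real.pi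
      · rw [toIocMod, toIocDiv_eq_of_sub_zsmul_mem_Ioc Real.two_pi_pos (n := k)]
        · exact h1
        · rw [zero_add]
          exact ⟨h3.1, ht⟩
      · rw [toIocMod, toIocDiv_eq_of_sub_zsmul_mem_Ioc Real.two_pi_pos (n := k + 1)]
        · exact h2
        · have := h3.2
          rw [add_smul, one_smul]
          push Not at ht
          constructor <;> linarith
    exact contDiffAt_const.congr_of_eventuallyEq this

/-- A function orthogonal to all smooth periodic functions vanishes. -/
lemma ae_eq_zero_of_periodic_test [CompleteSpace E] {f : ℝ → E}
    (hf : IntegrableOn f (Ioc 0 (2 * Real.pi)))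
    (h : ∀ χ : ℝ → ℝ, ContDiff ℝ ∞ χ → Function.Periodic χ (2 * Real.pi) →
      ∫ θ in Ioc 0 (2 * Real.pi), χ θ • f θ = 0) :
    ∀ᵐ θ ∂volume.restrict (Ioc 0 (2 * Real.pi)), f θ = 0 := by
  have h1 : ∀ᵐ θ : ℝ, θ ∈ Ioo 0 (2 * Real.pi) → f θ = 0 := by
    refine isOpen_Ioo.ae_eq_zero_of_integral_contDiff_smul_eq_zero
      (hf.mono_set Ioo_subset_Ioc_self).locallyIntegrableOn fun χ hχ _ hs => ?_
    have h2 := h _ (contDiff_comp_toIocMod hχ hs) (toIocMod_periodic Real.two_pi_pos 0 |>.comp χ)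
    rw [← setIntegral_eq_integral_of_forall_compl_eq_zero (s := Ioc 0 (2 * Real.pi)), ← h2]
    · refine setIntegral_congr_fun measurableSet_Ioc fun θ hθ => ?_
      rw [(toIocMod_eq_self Real.two_pi_pos).2 (by simpa using hθ)]
    · intro θ hθ
      rw [image_eq_zero_of_notMem_tsupport fun h' => hθ (Ioo_subset_Ioc_self (hs h')), zero_smul]
  rw [← restrict_Ioo_eq_restrict_Ioc, ae_restrict_iff' measurableSet_Ioo]
  exact h1

/-- `f₁` is the weak derivative of the `2π`-periodic function `f`. -/
def WeakDerivPer (f f₁ : ℝ → E) : Prop :=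
  ∀ χ : ℝ → ℝ, ContDiff ℝ ∞ χ → Function.Periodic χ (2 * Real.pi) →
    ∫ θ in Ioc 0 (2 * Real.pi), deriv χ θ • f θ = - ∫ θ in Ioc 0 (2 * Real.pi), χ θ • f₁ θ

lemma integral_coord {α : Type*} [MeasurableSpace α] {μ : Measure α} {ι : Type*} [Fintype ι]
    {f : α → EuclideanSpace ℝ ι} (hf : Integrable f μ) (i : ι) :
    (∫ a, f a ∂μ) i = ∫ a, f a i ∂μ :=
  ((EuclideanSpace.proj (𝕜 := ℝ) i).integral_comp_comm hf).symm

lemma integrableOn_smul_of_continuous {χ : ℝ → ℝ} (hχ : Continuous χ) {f : ℝ → E}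
    (hf : IntegrableOn f (Ioc 0 (2 * Real.pi))) :
    IntegrableOn (fun θ => χ θ • f θ) (Ioc 0 (2 * Real.pi)) := by
  obtain ⟨K, hK⟩ := (isCompact_Icc (a := (0 : ℝ)) (b := 2 * Real.pi)).exists_bound_of_continuousOn
    hχ.continuousOn
  refine Integrable.bdd_smul hf K hχ.aestronglyMeasurable ?_
  filter_upwards [ae_restrict_mem measurableSet_Ioc] with θ hθ
  exact hK θ (Ioc_subset_Icc_self hθ)

/-- Integration by parts over one period. -/
lemma weakDerivPer_of_absolutelyContinuous {f f₁ : ℝ → Vec m}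
    (hf : ∀ i, AbsolutelyContinuousOnInterval (fun θ => f θ i) 0 (2 * Real.pi))
    (hfi : IntegrableOn f (Ioc 0 (2 * Real.pi))) (hfi₁ : IntegrableOn f₁ (Ioc 0 (2 * Real.pi)))
    (hend : f 0 = f (2 * Real.pi))
    (hd : ∀ i, ∀ᵐ θ : ℝ, θ ∈ Ioc 0 (2 * Real.pi) → deriv (fun t => f t i) θ = f₁ θ i) :
    WeakDerivPer f f₁ := by
  intro χ hχ hper
  have hd' : ContDiff ℝ 1 χ := hχ.of_le (by simp)
  have hcd : Continuous (deriv χ) := hd'.continuous_deriv (by simp)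
  have hac : AbsolutelyContinuousOnInterval χ 0 (2 * Real.pi) :=
    hd'.contDiffOn.absolutelyContinuousOnInterval
  ext i
  rw [PiLp.neg_apply, integral_coord (integrableOn_smul_of_continuous hcd hfi),
    integral_coord (integrableOn_smul_of_continuous hχ.continuous hfi₁)]
  have h := hac.integral_mul_deriv_eq_deriv_mul (hf i)
  rw [hend, hper.eq, sub_self, zero_sub, intervalIntegral.integral_of_le Real.two_pi_pos.le,
    intervalIntegral.integral_of_le Real.two_pi_pos.le] at h
  simp only [PiLp.smul_apply, smul_eq_mul]
  rw [eq_neg_iff_add_eq_zero, ← neg_eq_iff_add_eq_zero, ← h]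
  refine setIntegral_congr_ae measurableSet_Ioc ?_
  filter_upwards [hd i] with θ hθ hmem
  rw [hθ hmem]

lemma intervalIntegrable_of_periodic {f : ℝ → Vec m} (hp : Function.Periodic f (2 * Real.pi))
    (hf : IntegrableOn f (Ioc 0 (2 * Real.pi))) (a b : ℝ) : IntervalIntegrable f volume a b := by
  refine hp.intervalIntegrable Real.two_pi_pos.ne' (t := 0) ?_ a b
  rwa [zero_add, intervalIntegrable_iff_integrableOn_Ioc_of_le Real.two_pi_pos.le]

/-- The primitive of a smooth periodic function of mean zero is smooth and periodic. -/
lemma exists_periodic_primitive {χ : ℝ → ℝ} (hχ : ContDiff ℝ ∞ χ)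
    (hper : Function.Periodic χ (2 * Real.pi)) (h0 : ∫ θ in 0..2 * Real.pi, χ θ = 0) :
    ∃ X : ℝ → ℝ, ContDiff ℝ ∞ X ∧ Function.Periodic X (2 * Real.pi) ∧ deriv X = χ := by
  have hd : ∀ θ, HasDerivAt (fun θ => ∫ t in 0..θ, χ t) (χ θ) θ := fun θ =>
    hχ.continuous.integral_hasStrictDerivAt 0 θ |>.hasDerivAt
  refine ⟨fun θ => ∫ t in 0..θ, χ t, ?_, ?_, ?_⟩
  · rw [contDiff_infty_iff_deriv]
    refine ⟨fun θ => (hd θ).differentiableAt, ?_⟩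
    rw [show deriv (fun θ => ∫ t in 0..θ, χ t) = χ from funext fun θ => (hd θ).deriv]
    exact hχ
  · intro θ
    have h1 := hper.intervalIntegral_add_eq θ 0
    rw [zero_add, h0] at h1
    simp only
    rw [← intervalIntegral.integral_add_adjacent_intervals (b := θ)
      (hχ.continuous.intervalIntegrable _ _) (hχ.continuous.intervalIntegrable _ _), h1, add_zero]
  · exact funext fun θ => (hd θ).deriv

/-- A periodic function with an integrable weak derivative is the primitive of the latter, up to a
constant and a null set; the weak derivative has mean zero. -/
lemma WeakDerivPer.exists_primitive {f f₁ : ℝ → Vec m} (h : WeakDerivPer f f₁)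
    (hp : Function.Periodic f (2 * Real.pi)) (hp₁ : Function.Periodic f₁ (2 * Real.pi))
    (hf : IntegrableOn f (Ioc 0 (2 * Real.pi))) (hf₁ : IntegrableOn f₁ (Ioc 0 (2 * Real.pi))) :
    ∃ c, ∀ᵐ θ : ℝ, f θ = c + ∫ t in 0..θ, f₁ t := by
  have hii := intervalIntegrable_of_periodic hp₁ hf₁
  have hmean : ∫ t in 0..2 * Real.pi, f₁ t = 0 := by
    have := h (fun _ => 1) contDiff_const (fun _ => rfl)
    rw [intervalIntegral.integral_of_le Real.two_pi_pos.le]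
    simpa using this
  set F : ℝ → Vec m := fun θ => ∫ t in 0..θ, f₁ t with hF
  have hFc : Continuous F := intervalIntegral.continuous_primitive hii 0
  have hFp : Function.Periodic F (2 * Real.pi) := by
    intro θ
    have h1 := hp₁.intervalIntegral_add_eq θ 0
    rw [zero_add, hmean] at h1
    simp only [hF]
    rw [← intervalIntegral.integral_add_adjacent_intervals (b := θ) (hii _ _) (hii _ _), h1,
      add_zero]
  have hFi : IntegrableOn F (Ioc 0 (2 * Real.pi)) :=
    (hFc.continuousOn.integrableOn_Icc).mono_set Ioc_subset_Icc_self
  have hcoord : ∀ i : Fin m, (fun θ => F θ i) = fun θ => ∫ t in 0..θ, f₁ t i := by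
    intro i
    ext θ
    exact ((EuclideanSpace.proj (𝕜 := ℝ) i).intervalIntegral_comp_comm (hii 0 θ)).symm
  have hiic : ∀ i : Fin m, IntervalIntegrable (fun t => f₁ t i) volume 0 (2 * Real.pi) := fun i =>
    intervalIntegrable_iff.2
      ((EuclideanSpace.proj (𝕜 := ℝ) i).integrable_comp (intervalIntegrable_iff.1 (hii 0 _)))
  have hFw : WeakDerivPer F f₁ := by
    refine weakDerivPer_of_absolutelyContinuous (fun i => ?_) hFi hf₁ ?_ fun i => ?_
    · rw [hcoord i]
      exact (hiic i).absolutelyContinuousOnInterval_intervalIntegral (by simp)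
    · exact (hFp.eq).symm
    · rw [hcoord i]
      filter_upwards [(hiic i).ae_hasDerivAt_integral] with θ hθ hmem
      have hmem' : θ ∈ uIcc 0 (2 * Real.pi) := by
        rw [uIcc_of_le Real.two_pi_pos.le]; exact Ioc_subset_Icc_self hmem
      exact (hθ hmem' 0 (by simp)).deriv
  -- `f - F` is orthogonal to all derivatives, that is, to all test functions of mean zero
  set c : Vec m := (2 * Real.pi)⁻¹ • ∫ θ in Ioc 0 (2 * Real.pi), (f θ - F θ) with hc
  have hfin : IntegrableOn (fun _ : ℝ => c) (Ioc 0 (2 * Real.pi)) :=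
    integrableOn_const measure_Ioc_lt_top.ne
  have hfF : IntegrableOn (fun θ => f θ - F θ) (Ioc 0 (2 * Real.pi)) := hf.sub hFi
  have hz := ae_eq_zero_of_periodic_test (f := fun θ => f θ - F θ - c) (hfF.sub hfin) ?_
  · refine ⟨c, ?_⟩
    have : ∀ᵐ θ : ℝ, f θ - F θ - c = 0 :=
      ae_of_periodic (fun θ => by rw [hp, hFp]) hz
    filter_upwards [this] with θ hθ
    rw [sub_sub, sub_eq_zero] at hθ
    rw [hθ, add_comm]
  · intro χ hχ hper
    set κ : ℝ := (2 * Real.pi)⁻¹ * ∫ θ in Ioc 0 (2 * Real.pi), χ θ with hκ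
    have hχi : IntegrableOn χ (Ioc 0 (2 * Real.pi)) :=
      (hχ.continuous.continuousOn.integrableOn_Icc).mono_set Ioc_subset_Icc_self
    obtain ⟨X, hX, hXp, hXd⟩ := exists_periodic_primitive (χ := fun θ => χ θ - κ)
      (hχ.sub contDiff_const) (fun θ => by simp only [hper θ]) (by
        rw [intervalIntegral.integral_of_le Real.two_pi_pos.le,
          integral_sub hχi (integrableOn_const measure_Ioc_lt_top.ne)]
        simp [hκ, Real.two_pi_pos.le]
        field_simp
        ring)
    have e1 := h X hX hXp
    rw [← hFw X hX hXp, hXd] at e1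
    have i1 := integrableOn_smul_of_continuous hχ.continuous hfF
    have i2 : IntegrableOn (fun θ => κ • (f θ - F θ)) (Ioc 0 (2 * Real.pi)) := hfF.smul κ
    have i3 : IntegrableOn (fun θ => χ θ • c) (Ioc 0 (2 * Real.pi)) := hχi.smul_const c
    have e2 : ∫ θ in Ioc 0 (2 * Real.pi), (χ θ • (f θ - F θ) - κ • (f θ - F θ)) = 0 := by
      have hcc : Continuous fun θ => χ θ - κ := hχ.continuous.sub continuous_const
      rw [← sub_eq_zero, ← integral_sub (integrableOn_smul_of_continuous hcc hf)
        (integrableOn_smul_of_continuous hcc hFi)] at e1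
      rw [← e1]
      congr 1
      ext1 θ
      module
    rw [integral_sub i1 i2, sub_eq_zero, integral_smul] at e2
    simp_rw [smul_sub (_ : ℝ) _ c]
    rw [integral_sub i1 i3, e2, integral_smul_const, hc, hκ, smul_smul, mul_comm, sub_self]

end

/-! ### Weak gradients near the origin -/

section

variable {m : ℕ}

/-- The rotation of the plane by a right angle. -/
def rot (x : Plane) : Plane := !₂[-x 1, x 0]

lemma rot_polar (p : ℝ × ℝ) : rot (polar p) = p.1 • et p.2 := by
  ext i; fin_cases i <;> simp [rot, polar]

lemma norm_rot (x : Plane) : ‖rot x‖ = ‖x‖ := by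
  simp [EuclideanSpace.norm_eq, Fin.sum_univ_two, rot, add_comm]

@[fun_prop] lemma continuous_rot : Continuous rot := by unfold rot; fun_prop

/-- `D` is a weak gradient of `u^g` in the ball of radius `R` about the origin, cut off outside the
ball and chosen strongly measurable. -/
structure IsLocalGrad (g : S1 → Vec m) (R : ℝ) (D : Plane → Mat m) : Prop where
  pos : 0 < R
  meas : StronglyMeasurable D
  int : Integrable D
  sq : Integrable fun x => ‖D x‖ ^ 2
  intU : Integrable ((Metric.ball 0 R).indicator (oneHom g))
  weak : ∀ ψ : Plane → ℝ, ContDiff ℝ ∞ ψ → HasCompactSupport ψ → tsupport ψ ⊆ Metric.ball 0 R →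
    ∀ (i : Fin m) (j : Fin 2),
      ∫ x, partialD j ψ x * (Metric.ball 0 R).indicator (oneHom g) x i
        = - ∫ x, ψ x * D x (i, j)

/-- The gradient `g ⊗ e_r + h ⊗ e_θ` of `u^g`, as a function of the polar angle, where `h` is the
derivative of `g`. -/
def gradPolar (g : S1 → Vec m) (h : ℝ → Vec m) (θ : ℝ) : Mat m :=
  dyad (g (circ θ)) (er θ) + dyad (h θ) (et θ)

section

variable {E : Type*} [NormedAddCommGroup E] [NormedSpace ℝ E]

lemma integrable_smul_of_compactSupport {f : Plane → E} (hf : Integrable f) {ψ : Plane → ℝ}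
    (hψ : Continuous ψ) (hc : HasCompactSupport ψ) : Integrable fun x => ψ x • f x := by
  obtain ⟨K, hK⟩ := hc.exists_bound_of_continuous hψ
  exact Integrable.bdd_smul hf K hψ.aestronglyMeasurable (Filter.Eventually.of_forall hK)

lemma continuous_partialD {ψ : Plane → ℝ} (hψ : ContDiff ℝ ∞ ψ) (j : Fin 2) :
    Continuous (partialD j ψ) :=
  (hψ.continuous_fderiv (by simp)).clm_apply continuous_const

lemma hasCompactSupport_partialD {ψ : Plane → ℝ} (hψ : HasCompactSupport ψ) (j : Fin 2) :
    HasCompactSupport (partialD j ψ) :=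
  hψ.fderiv_apply (𝕜 := ℝ) _

/-- A property of almost every radius holds for some radius in `(0, R)`. -/
lemma exists_radius {R : ℝ} (hR : 0 < R) {q : ℝ → Prop} (hq : ∀ᵐ r ∂volume.restrict (Ioi 0), q r) :
    ∃ r, 0 < r ∧ r < R ∧ q r := by
  have h1 : ∀ᵐ r ∂volume.restrict (Ioo 0 R), q r :=
    ae_mono (Measure.restrict_mono Ioo_subset_Ioi_self le_rfl) hq
  have : (ae (volume.restrict (Ioo 0 R))).NeBot := by
    rw [ae_neBot]
    intro h
    rw [Measure.restrict_eq_zero, Real.volume_Ioo] at h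
    simp [hR.not_ge] at h
  obtain ⟨r, h2, h3⟩ := (h1.and (ae_restrict_mem measurableSet_Ioo)).exists
  exact ⟨r, h3.1, h3.2, h2⟩

end

namespace IsLocalGrad

variable {g : S1 → Vec m} {R : ℝ} {D : Plane → Mat m}

lemma indicator_polar (R : ℝ) (g : S1 → Vec m) {p : ℝ × ℝ} (hp : 0 < p.1) (hR : p.1 < R) :
    (Metric.ball 0 R).indicator (oneHom g) (polar p) = p.1 • g (circ p.2) := by
  rw [indicator_of_mem, oneHom_polar g hp]
  simpa [norm_polar hp.le] using hR

/-- The weak gradient tested with a smooth vector field. -/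
lemma weak_field (H : IsLocalGrad g R D) {ψ₀ ψ₁ : Plane → ℝ} (h₀ : ContDiff ℝ ∞ ψ₀)
    (h₁ : ContDiff ℝ ∞ ψ₁) (c₀ : HasCompactSupport ψ₀) (c₁ : HasCompactSupport ψ₁)
    (s₀ : tsupport ψ₀ ⊆ Metric.ball 0 R) (s₁ : tsupport ψ₁ ⊆ Metric.ball 0 R) :
    ∫ x, (partialD 0 ψ₀ x + partialD 1 ψ₁ x) • (Metric.ball 0 R).indicator (oneHom g) x
      = - ∫ x, mulV (D x) !₂[ψ₀ x, ψ₁ x] := by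
  have coordU : ∀ i, Integrable fun x => (Metric.ball 0 R).indicator (oneHom g) x i := fun i =>
    (EuclideanSpace.proj (𝕜 := ℝ) i).integrable_comp H.intU
  have coordD : ∀ q, Integrable fun x => D x q := fun q =>
    (EuclideanSpace.proj (𝕜 := ℝ) q).integrable_comp H.int
  have iU0 : ∀ i, Integrable fun x =>
      partialD 0 ψ₀ x * (Metric.ball 0 R).indicator (oneHom g) x i := fun i =>
    integrable_smul_of_compactSupport (coordU i) (continuous_partialD h₀ 0)
      (hasCompactSupport_partialD c₀ 0)
  have iU1 : ∀ i, Integrable fun x =>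
      partialD 1 ψ₁ x * (Metric.ball 0 R).indicator (oneHom g) x i := fun i =>
    integrable_smul_of_compactSupport (coordU i) (continuous_partialD h₁ 1)
      (hasCompactSupport_partialD c₁ 1)
  have iD0 : ∀ i, Integrable fun x => ψ₀ x * D x (i, 0) := fun i =>
    integrable_smul_of_compactSupport (coordD _) h₀.continuous c₀
  have iD1 : ∀ i, Integrable fun x => ψ₁ x * D x (i, 1) := fun i =>
    integrable_smul_of_compactSupport (coordD _) h₁.continuous c₁
  have iU : Integrable fun x =>
      (partialD 0 ψ₀ x + partialD 1 ψ₁ x) • (Metric.ball 0 R).indicator (oneHom g) x :=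
    integrable_smul_of_compactSupport H.intU
      ((continuous_partialD h₀ 0).add (continuous_partialD h₁ 1))
      ((hasCompactSupport_partialD c₀ 0).add (hasCompactSupport_partialD c₁ 1))
  have iD : Integrable fun x => mulV (D x) !₂[ψ₀ x, ψ₁ x] := by
    have : (fun x => mulV (D x) !₂[ψ₀ x, ψ₁ x])
        = fun x => WithLp.toLp 2 fun i => ψ₀ x * D x (i, 0) + ψ₁ x * D x (i, 1) := by
      ext x i
      simp
      ring
    rw [this]
    have h := Integrable.of_eval fun i => (iD0 i).add (iD1 i)
    exact (PiLp.continuousLinearEquiv 2 ℝ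
      (fun _ : Fin m => ℝ)).symm.toContinuousLinearMap.integrable_comp h
  ext i
  rw [PiLp.neg_apply, integral_coord iU, integral_coord iD]
  have e0 := H.weak ψ₀ h₀ c₀ s₀ i 0
  have e1 := H.weak ψ₁ h₁ c₁ s₁ i 1
  have e2 : ∫ x, ((partialD 0 ψ₀ x + partialD 1 ψ₁ x) •
        (Metric.ball 0 R).indicator (oneHom g) x) i
      = ∫ x, (partialD 0 ψ₀ x * (Metric.ball 0 R).indicator (oneHom g) x i
        + partialD 1 ψ₁ x * (Metric.ball 0 R).indicator (oneHom g) x i) := by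
    congr 1; ext x; simp; ring
  have e3 : ∫ x, mulV (D x) !₂[ψ₀ x, ψ₁ x] i
      = ∫ x, (ψ₀ x * D x (i, 0) + ψ₁ x * D x (i, 1)) := by
    congr 1; ext x; simp; ring
  rw [e2, e3, integral_add (iU0 i) (iU1 i), integral_add (iD0 i) (iD1 i), e0, e1]
  ring

lemma tsupport_mul_subset {f ψ : Plane → ℝ} {s : Set Plane} (h : tsupport ψ ⊆ s) :
    tsupport (fun x => f x * ψ x) ⊆ s :=
  (tsupport_mul_subset_right).trans h

lemma partialD_coord_mul {ψ : Plane → ℝ} (hψ : ContDiff ℝ ∞ ψ) (j k : Fin 2) (x : Plane) :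
    partialD j (fun y : Plane => y k * ψ y) x
      = (if k = j then ψ x else 0) + x k * partialD j ψ x := by
  have h1 : HasFDerivAt (fun y : Plane => y k) (EuclideanSpace.proj (𝕜 := ℝ) k) x :=
    (EuclideanSpace.proj (𝕜 := ℝ) k : Plane →L[ℝ] ℝ).hasFDerivAt
  have h2 := h1.mul ((hψ.differentiable (by simp)) x).hasFDerivAt
  rw [partialD, HasFDerivAt.fderiv (f := fun y : Plane => y k * ψ y) h2]
  have h3 : (EuclideanSpace.proj k : Plane →L[ℝ] ℝ) (EuclideanSpace.single j 1)
      = if k = j then 1 else 0 := by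
    change (EuclideanSpace.single j (1 : ℝ) : Plane) k = _
    simp
  simp only [partialD, _root_.add_apply, _root_.smul_apply, h3, smul_eq_mul, mul_ite, mul_one,
    mul_zero]
  ring

/-- The weak gradient tested with the field `ψ(x) x`. -/
lemma weak_radial (H : IsLocalGrad g R D) {ψ : Plane → ℝ} (hψ : ContDiff ℝ ∞ ψ)
    (c : HasCompactSupport ψ) (s : tsupport ψ ⊆ Metric.ball 0 R) :
    ∫ x, (2 * ψ x + fderiv ℝ ψ x x) • (Metric.ball 0 R).indicator (oneHom g) x
      = - ∫ x, ψ x • mulV (D x) x := by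
  have h := H.weak_field (ψ₀ := fun x => x 0 * ψ x) (ψ₁ := fun x => x 1 * ψ x)
    (by fun_prop) (by fun_prop) c.mul_left c.mul_left
    (tsupport_mul_subset s) (tsupport_mul_subset s)
  refine (integral_congr_ae (.of_forall fun x => ?_)).trans
    (h.trans (congrArg Neg.neg (integral_congr_ae (.of_forall fun x => ?_))))
  · simp only
    rw [partialD_coord_mul hψ, partialD_coord_mul hψ, fderiv_apply_eq]
    simp only [if_true]
    congr 1
    ring
  · simp only
    rw [← mulV_smul_right]
    congr 1
    ext i
    fin_cases i <;> simp [mul_comm]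

/-- The weak gradient tested with the field `ψ(x) x^⊥`; as `x^⊥` is divergence free, only the
derivative of `ψ` along it appears. -/
lemma weak_angular (H : IsLocalGrad g R D) {ψ : Plane → ℝ} (hψ : ContDiff ℝ ∞ ψ)
    (c : HasCompactSupport ψ) (s : tsupport ψ ⊆ Metric.ball 0 R) :
    ∫ x, (fderiv ℝ ψ x (rot x)) • (Metric.ball 0 R).indicator (oneHom g) x
      = - ∫ x, ψ x • mulV (D x) (rot x) := by
  have hneg : (fun x : Plane => x 1 * -ψ x) = fun x => -(x 1 * ψ x) := by ext; ring
  have h := H.weak_field (ψ₀ := fun x => x 1 * -ψ x) (ψ₁ := fun x => x 0 * ψ x)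
    (by fun_prop) (by fun_prop) c.neg.mul_left c.mul_left
    (tsupport_mul_subset ((tsupport_neg ψ).trans_subset s)) (tsupport_mul_subset s)
  refine (integral_congr_ae (.of_forall fun x => ?_)).trans
    (h.trans (congrArg Neg.neg (integral_congr_ae (.of_forall fun x => ?_))))
  · simp only
    rw [partialD_coord_mul hψ.neg, partialD_coord_mul hψ, fderiv_apply_eq]
    have : partialD 0 (fun x => -ψ x) x = - partialD 0 ψ x := by
      simp [partialD]
    rw [this]
    simp [rot]
  · simp only
    rw [← mulV_smul_right]
    congr 1
    ext i
    fin_cases i <;> simp [mul_comm, rot]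

end IsLocalGrad

end

/-! ### Euler's identity for the weak gradient -/

section

variable {m : ℕ} {E : Type*} [NormedAddCommGroup E] [NormedSpace ℝ E]

lemma integral_polarDom {F : ℝ × ℝ → E} (hF : Integrable F polarDom) :
    ∫ p, F p ∂polarDom = ∫ r in Ioi 0, ∫ θ in Ioc 0 (2 * Real.pi), F (r, θ) :=
  integral_prod _ hF

lemma integral_polarDom_symm {F : ℝ × ℝ → E} (hF : Integrable F polarDom) :
    ∫ p, F p ∂polarDom = ∫ θ in Ioc 0 (2 * Real.pi), ∫ r in Ioi 0, F (r, θ) :=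
  integral_prod_symm _ hF

lemma fderiv_eq_zero_of_notMem_tsupport {ψ : Plane → ℝ} {x : Plane} (hx : x ∉ tsupport ψ) :
    fderiv ℝ ψ x = 0 :=
  image_eq_zero_of_notMem_tsupport fun h => hx (tsupport_fderiv_subset ℝ h)

lemma hasCompactSupport_fderiv_apply {ψ : Plane → ℝ} (hc : HasCompactSupport ψ)
    (X : Plane → Plane) : HasCompactSupport fun x => fderiv ℝ ψ x (X x) :=
  HasCompactSupport.intro hc.isCompact fun x hx => by
    simp [fderiv_eq_zero_of_notMem_tsupport hx]

lemma notMem_tsupport_polar {ψ : Plane → ℝ} {R : ℝ} (s : tsupport ψ ⊆ Metric.ball 0 R)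
    {p : ℝ × ℝ} (hp : 0 < p.1) (h : ¬ p.1 < R) : polar p ∉ tsupport ψ := fun h' => by
  have := s h'
  rw [mem_ball_zero_iff, norm_polar hp.le] at this
  exact h this

/-- The integral over a ray of `d/dr (r³ ψ)` vanishes. -/
lemma integral_deriv_cube_mul {ψ : Plane → ℝ} (hψ : ContDiff ℝ ∞ ψ) (hc : HasCompactSupport ψ)
    (θ : ℝ) : ∫ r in Ioi 0,
      (3 * r ^ 2 * ψ (polar (r, θ)) + r ^ 3 * fderiv ℝ ψ (polar (r, θ)) (er θ)) = 0 := by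
  have hd : ∀ r, HasDerivAt (fun r => r ^ 3 * ψ (polar (r, θ)))
      (3 * r ^ 2 * ψ (polar (r, θ)) + r ^ 3 * fderiv ℝ ψ (polar (r, θ)) (er θ)) r := fun r => by
    have := (hasDerivAt_pow 3 r).fun_mul
      (hasDerivAt_comp_polar_fst (r := r) (θ := θ) ((hψ.differentiable (by simp)) _))
    simpa using this
  have h1 : ContDiff ℝ 1 fun r => r ^ 3 * ψ (polar (r, θ)) := by
    apply ContDiff.of_le (n := ∞) _ (by simp)
    exact (contDiff_id.pow 3).mul
      (hψ.comp (contDiff_polar.comp (contDiff_id.prodMk contDiff_const)))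
  have h2 : HasCompactSupport fun r => r ^ 3 * ψ (polar (r, θ)) := by
    obtain ⟨K, hK⟩ := hc.isCompact.isBounded.subset_closedBall 0
    refine HasCompactSupport.intro (isCompact_closedBall (0 : ℝ) K) fun r hr => ?_
    have h : polar (r, θ) ∉ tsupport ψ := fun h => hr (by
      simpa [polar, norm_smul, norm_er] using hK h)
    rw [image_eq_zero_of_notMem_tsupport h, mul_zero]
  have h3 := h2.integral_Ioi_deriv_eq h1 0
  rw [show deriv (fun r => r ^ 3 * ψ (polar (r, θ))) = _ from funext fun r => (hd r).deriv] at h3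
  simpa using h3

namespace IsLocalGrad

variable {g : S1 → Vec m} {R : ℝ} {D : Plane → Mat m}

/-- One-homogeneity of `u^g` in weak form: along each ray the integrand is `d/dr (r³ ψ)` times the
constant `g(θ)`. -/
lemma integral_radial (H : IsLocalGrad g R D) {ψ : Plane → ℝ} (hψ : ContDiff ℝ ∞ ψ)
    (c : HasCompactSupport ψ) (s : tsupport ψ ⊆ Metric.ball 0 R) :
    ∫ x, (3 * ψ x + fderiv ℝ ψ x x) • (Metric.ball 0 R).indicator (oneHom g) x = 0 := by
  have hi : Integrable fun x =>
      (3 * ψ x + fderiv ℝ ψ x x) • (Metric.ball 0 R).indicator (oneHom g) x := by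
    refine integrable_smul_of_compactSupport H.intU ?_ ?_
    · exact (continuous_const.mul hψ.continuous).add
        ((hψ.continuous_fderiv (by simp)).clm_apply continuous_id)
    · exact c.mul_left.add (hasCompactSupport_fderiv_apply c fun x => x)
  have hp : ∀ᵐ p ∂polarDom, p.1 • ((3 * ψ (polar p) + fderiv ℝ ψ (polar p) (polar p)) •
      (Metric.ball 0 R).indicator (oneHom g) (polar p))
      = (3 * p.1 ^ 2 * ψ (polar p) + p.1 ^ 3 * fderiv ℝ ψ (polar p) (er p.2)) •
        g (circ p.2) := by
    filter_upwards [ae_polarDom_pos] with p hp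
    by_cases h : p.1 < R
    · rw [indicator_polar R g hp h]
      have : fderiv ℝ ψ (polar p) (polar p) = p.1 * fderiv ℝ ψ (polar p) (er p.2) := by
        conv_lhs => enter [2]; rw [polar]
        rw [map_smul, smul_eq_mul]
      rw [this]
      simp only [smul_smul]
      congr 1
      ring
    · have h' := notMem_tsupport_polar s hp h
      simp [image_eq_zero_of_notMem_tsupport h', fderiv_eq_zero_of_notMem_tsupport h']
  rw [integral_polar hi.1, integral_congr_ae hp,
    integral_polarDom_symm ((integrable_polar hi).congr hp)]
  simp only [integral_smul_const, integral_deriv_cube_mul hψ c, zero_smul, integral_zero]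

lemma integrableOn_mulV (H : IsLocalGrad g R D) {X : Plane → Plane} (hX : Continuous X)
    (hXn : ∀ x, ‖X x‖ = ‖x‖) :
    IntegrableOn (fun x => mulV (D x) (X x)) (Metric.ball 0 R) := by
  refine Integrable.mono' (H.int.norm.mul_const R).integrableOn ?_ ?_
  · exact (continuous_mulV.comp_stronglyMeasurable
      (H.meas.prodMk hX.stronglyMeasurable)).aestronglyMeasurable
  · filter_upwards [ae_restrict_mem Metric.isOpen_ball.measurableSet] with x hx
    refine (norm_mulV_le _ _).trans ?_
    rw [hXn]
    exact mul_le_mul_of_nonneg_left (mem_ball_zero_iff.1 hx).le (norm_nonneg _)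

lemma integrable_smul_mulV (H : IsLocalGrad g R D) {X : Plane → Plane} (hX : Continuous X)
    {ψ : Plane → ℝ} (hψ : Continuous ψ) (hc : HasCompactSupport ψ) :
    Integrable fun x => ψ x • mulV (D x) (X x) := by
  have hcont : Continuous fun x => |ψ x| * ‖X x‖ := by fun_prop
  have hcs : HasCompactSupport fun x => |ψ x| * ‖X x‖ :=
    HasCompactSupport.intro hc.isCompact fun x hx => by
      simp [image_eq_zero_of_notMem_tsupport hx]
  obtain ⟨K, hK⟩ := hcs.exists_bound_of_continuous hcont
  refine Integrable.mono' (H.int.norm.mul_const K) ?_ (Filter.Eventually.of_forall fun x => ?_)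
  · exact (hψ.stronglyMeasurable.smul (continuous_mulV.comp_stronglyMeasurable
      (H.meas.prodMk hX.stronglyMeasurable))).aestronglyMeasurable
  · rw [norm_smul]
    calc ‖ψ x‖ * ‖mulV (D x) (X x)‖ ≤ |ψ x| * (‖D x‖ * ‖X x‖) :=
          mul_le_mul_of_nonneg_left (norm_mulV_le _ _) (norm_nonneg _)
      _ = ‖D x‖ * (|ψ x| * ‖X x‖) := by ring
      _ ≤ ‖D x‖ * K := mul_le_mul_of_nonneg_left ((le_abs_self _).trans (hK x)) (norm_nonneg _)

/-- Euler's identity `Du(x) x = u(x)` for the one-homogeneous map. -/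
lemma ae_mulV_self (H : IsLocalGrad g R D) : ∀ᵐ x, x ∈ Metric.ball (0 : Plane) R →
    mulV (D x) x = oneHom g x := by
  have h1 := Metric.isOpen_ball.ae_eq_zero_of_integral_contDiff_smul_eq_zero (μ := volume)
    (U := Metric.ball (0 : Plane) R)
    (f := fun x => mulV (D x) x - (Metric.ball 0 R).indicator (oneHom g) x)
    ((H.integrableOn_mulV continuous_id fun _ => rfl).sub
      H.intU.integrableOn).locallyIntegrableOn fun ψ hψ c s => ?_
  · filter_upwards [h1] with x hx hmem
    have := hx hmem
    rw [indicator_of_mem hmem, sub_eq_zero] at this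
    exact this
  · have i1 : Integrable fun x => ψ x • mulV (D x) x :=
      H.integrable_smul_mulV continuous_id hψ.continuous c
    have i2 := integrable_smul_of_compactSupport H.intU hψ.continuous c
    have i3 : Integrable fun x =>
        (2 * ψ x + fderiv ℝ ψ x x) • (Metric.ball 0 R).indicator (oneHom g) x := by
      refine integrable_smul_of_compactSupport H.intU ?_ ?_
      · exact (continuous_const.mul hψ.continuous).add
          ((hψ.continuous_fderiv (by simp)).clm_apply continuous_id)
      · exact c.mul_left.add (hasCompactSupport_fderiv_apply c fun x => x)
    simp_rw [smul_sub]
    have e := H.integral_radial hψ c s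
    have : (fun x => (3 * ψ x + fderiv ℝ ψ x x) • (Metric.ball 0 R).indicator (oneHom g) x)
        = fun x => (2 * ψ x + fderiv ℝ ψ x x) • (Metric.ball 0 R).indicator (oneHom g) x
          + ψ x • (Metric.ball 0 R).indicator (oneHom g) x := by
      ext1 x; module
    rw [this, integral_add i3 i2, H.weak_radial hψ c s] at e
    rw [integral_sub i1 i2, sub_eq_zero]
    exact (neg_add_eq_zero.1 e)

/-- The angular part of the weak gradient identity, in polar coordinates. -/
lemma integral_angular (H : IsLocalGrad g R D) {ψ : Plane → ℝ} (hψ : ContDiff ℝ ∞ ψ)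
    (c : HasCompactSupport ψ) (s : tsupport ψ ⊆ Metric.ball 0 R) :
    Integrable (fun p : ℝ × ℝ => (p.1 ^ 2 * (p.1 * fderiv ℝ ψ (polar p) (et p.2))) • g (circ p.2))
      polarDom ∧
    ∫ p, (p.1 ^ 2 * (p.1 * fderiv ℝ ψ (polar p) (et p.2))) • g (circ p.2) ∂polarDom
      = - ∫ x, ψ x • mulV (D x) (rot x) := by
  have hi : Integrable fun x =>
      (fderiv ℝ ψ x (rot x)) • (Metric.ball 0 R).indicator (oneHom g) x :=
    integrable_smul_of_compactSupport H.intU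
      ((hψ.continuous_fderiv (by simp)).clm_apply continuous_rot)
      (hasCompactSupport_fderiv_apply c rot)
  have hp : ∀ᵐ p ∂polarDom, p.1 • (fderiv ℝ ψ (polar p) (rot (polar p)) •
      (Metric.ball 0 R).indicator (oneHom g) (polar p))
      = (p.1 ^ 2 * (p.1 * fderiv ℝ ψ (polar p) (et p.2))) • g (circ p.2) := by
    filter_upwards [ae_polarDom_pos] with p hp
    by_cases h : p.1 < R
    · rw [indicator_polar R g hp h, rot_polar, map_smul, smul_eq_mul]
      simp only [smul_smul]
      congr 1
      ring
    · simp [fderiv_eq_zero_of_notMem_tsupport (notMem_tsupport_polar s hp h)]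
  refine ⟨(integrable_polar hi).congr hp, ?_⟩
  rw [← integral_congr_ae hp, ← integral_polar hi.1]
  exact H.weak_angular hψ c s

/-- `g` is integrable on the circle, since `u^g` is integrable on almost every circle. -/
lemma integrableOn_circle (H : IsLocalGrad g R D) :
    IntegrableOn (fun θ => g (circ θ)) (Ioc 0 (2 * Real.pi)) := by
  have h1 : ∀ᵐ r ∂volume.restrict (Ioi 0), IntegrableOn
      (fun θ => r • (Metric.ball 0 R).indicator (oneHom g) (polar (r, θ)))
      (Ioc 0 (2 * Real.pi)) := (integrable_polar H.intU).prod_right_ae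
  obtain ⟨r, hr, hrR, h2⟩ := exists_radius H.pos h1
  have h3 := h2.smul (r⁻¹ * r⁻¹)
  refine h3.congr (Filter.Eventually.of_forall fun θ => ?_)
  simp only [Pi.smul_apply]
  rw [indicator_polar R g (p := (r, θ)) hr hrR, smul_smul, smul_smul,
    show r⁻¹ * r⁻¹ * r * r = 1 by field_simp, one_smul]

end IsLocalGrad

end

/-! ### The angular derivative -/

section

variable {m : ℕ}

/-- A smooth bump function with compact support in `(0, R)` and positive moments. -/
lemma exists_bump {R : ℝ} (hR : 0 < R) : ∃ η : ℝ → ℝ, ContDiff ℝ ∞ η ∧ HasCompactSupport η ∧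
    tsupport η ⊆ Ioo 0 R ∧ ∀ k : ℕ, 0 < ∫ r in Ioi 0, r ^ k * η r := by
  let f : ContDiffBump (R / 2) := ⟨R / 8, R / 4, by positivity, by linarith⟩
  have hs : tsupport f ⊆ Ioo 0 R := by
    rw [f.tsupport_eq, Real.closedBall_eq_Icc]
    intro x hx
    have h1 : R / 2 - R / 4 ≤ x := hx.1
    have h2 : x ≤ R / 2 + R / 4 := hx.2
    constructor <;> linarith
  refine ⟨f, f.contDiff, f.hasCompactSupport, hs, fun k => ?_⟩
  have h0 : ∀ r ∉ Ioi (0 : ℝ), r ^ k * f r = 0 := fun r hr => by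
    rw [image_eq_zero_of_notMem_tsupport fun h => hr (hs h).1, mul_zero]
  rw [setIntegral_eq_integral_of_forall_compl_eq_zero h0]
  refine Continuous.integral_pos_of_hasCompactSupport_nonneg_nonzero (x := R / 2)
    ((continuous_pow k).mul f.continuous) f.hasCompactSupport.mul_left (fun r => ?_) ?_
  · by_cases hr : r ∈ Ioi (0 : ℝ)
    · exact mul_nonneg (pow_nonneg (le_of_lt hr) k) f.nonneg
    · exact (h0 r hr).ge
  · have : f (R / 2) = 1 := f.one_of_mem_closedBall (by simp [f.rIn_pos.le])
    rw [this]
    positivity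

namespace IsLocalGrad

variable {g : S1 → Vec m} {R : ℝ} {D : Plane → Mat m}

/-- The angular part of the weak gradient, averaged over `r`, is the weak derivative of `g`. -/
lemma exists_weakDeriv (H : IsLocalGrad g R D) : ∃ h : ℝ → Vec m, StronglyMeasurable h ∧
    Function.Periodic h (2 * Real.pi) ∧ IntegrableOn h (Ioc 0 (2 * Real.pi)) ∧
    WeakDerivPer (fun θ => g (circ θ)) h := by
  obtain ⟨η, hη, ηc, ηs, ηpos⟩ := exists_bump H.pos
  have hη0 : tsupport η ⊆ Ioi 0 := fun r hr => (ηs hr).1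
  set κ : ℝ := ∫ r in Ioi 0, r ^ 2 * η r with hκ
  have hκ0 : κ ≠ 0 := (ηpos 2).ne'
  set F : ℝ × ℝ → Vec m := fun p => (p.1 * η p.1) • mulV (D (polar p)) (rot (polar p)) with hF
  have hFm : StronglyMeasurable F :=
    ((continuous_fst.mul (hη.continuous.comp continuous_fst)).stronglyMeasurable).smul
      (continuous_mulV.comp_stronglyMeasurable ((H.meas.comp_measurable
        continuous_polar.measurable).prodMk (continuous_rot.comp continuous_polar).stronglyMeasurable))
  have sep1 : ∀ {χ : ℝ → ℝ}, ContDiff ℝ ∞ χ → Function.Periodic χ (2 * Real.pi) →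
      Integrable (fun p : ℝ × ℝ => χ p.2 • F p) polarDom ∧
      ∫ p, p.1 • (sep η χ (polar p) • mulV (D (polar p)) (rot (polar p))) ∂polarDom
        = ∫ p, χ p.2 • F p ∂polarDom := by
    intro χ hχ hper
    have h1 : ∀ᵐ p ∂polarDom, p.1 • (sep η χ (polar p) • mulV (D (polar p)) (rot (polar p)))
        = χ p.2 • F p := by
      filter_upwards [ae_polarDom_pos] with p hp
      rw [sep_polar hper hp, hF]
      simp only [smul_smul]
      congr 1
      ring
    exact ⟨(integrable_polar (H.integrable_smul_mulV continuous_rot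
      (contDiff_sep hη hη0 hχ hper).continuous (hasCompactSupport_sep χ ηc))).congr h1,
      integral_congr_ae h1⟩
  have hFi : Integrable F polarDom := by
    simpa using (sep1 (χ := fun _ => 1) contDiff_const fun _ => rfl).1
  -- the average with weight `r η(r)`; it is periodic everywhere because `polar` is
  refine ⟨fun θ => κ⁻¹ • ∫ r in Ioi 0, F (r, θ), ?_, ?_, ?_, ?_⟩
  · exact (StronglyMeasurable.integral_prod_left' (μ := volume.restrict (Ioi 0)) hFm).const_smul
      κ⁻¹
  · intro θ
    have : ∀ r, polar (r, θ + 2 * Real.pi) = polar (r, θ) := fun r => by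
      simp [polar, er_periodic θ]
    simp only [hF, this]
  · exact (Integrable.integral_prod_right (μ := volume.restrict (Ioi 0))
      (ν := volume.restrict (Ioc 0 (2 * Real.pi))) hFi).smul κ⁻¹
  · intro χ hχ hper
    have hψ := contDiff_sep hη hη0 hχ hper
    have hs : tsupport (sep η χ) ⊆ Metric.ball 0 R := fun x hx => by
      have := ηs (tsupport_sep_subset η χ hx)
      simpa using this.2
    obtain ⟨-, e1⟩ := H.integral_angular hψ (hasCompactSupport_sep χ ηc) hs
    have e2 : ∫ p, (p.1 ^ 2 * (p.1 * fderiv ℝ (sep η χ) (polar p) (et p.2))) • g (circ p.2)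
        ∂polarDom = κ • ∫ θ in Ioc 0 (2 * Real.pi), deriv χ θ • g (circ θ) := by
      rw [hκ, ← integral_prod_smul]
      refine integral_congr_ae ?_
      filter_upwards [ae_polarDom_pos] with p hp
      rw [fderiv_sep_et hη hη0 hχ hper hp, smul_smul, mul_assoc]
    have e3 : ∫ x, sep η χ x • mulV (D x) (rot x)
        = ∫ θ in Ioc 0 (2 * Real.pi), χ θ • ∫ r in Ioi 0, F (r, θ) := by
      rw [integral_polar (H.integrable_smul_mulV continuous_rot hψ.continuous
        (hasCompactSupport_sep χ ηc)).1, (sep1 hχ hper).2,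
        integral_polarDom_symm (sep1 hχ hper).1]
      simp only [integral_smul]
    rw [e2, e3] at e1
    simp only [smul_comm (_ : ℝ) κ⁻¹, integral_smul]
    rw [← smul_neg, ← e1, smul_smul, inv_mul_cancel₀ hκ0, one_smul]

/-- The angular part of the weak gradient is `|x| h(arg x)`, where `h` is the weak derivative of
`g`. -/
lemma ae_mulV_rot (H : IsLocalGrad g R D) {h : ℝ → Vec m} (hm : StronglyMeasurable h)
    (hp : Function.Periodic h (2 * Real.pi)) (hi : IntegrableOn h (Ioc 0 (2 * Real.pi)))
    (hw : WeakDerivPer (fun θ => g (circ θ)) h) :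
    ∀ᵐ x, x ∈ Metric.ball (0 : Plane) R → mulV (D x) (rot x) = ‖x‖ • h (angle x) := by
  set V : Plane → Vec m := fun x => ‖x‖ • h (angle x) with hV
  have hVm : StronglyMeasurable V :=
    continuous_norm.stronglyMeasurable.smul (hm.comp_measurable measurable_angle)
  have hVp : ∀ p : ℝ × ℝ, 0 < p.1 → V (polar p) = p.1 • h p.2 := fun p h0 => by
    rw [hV]
    simp only
    rw [norm_polar h0.le, angle_polar h0 hp]
  have hVi : Integrable ((Metric.ball 0 R).indicator V) := by
    refine integrable_of_polar
      (hVm.indicator Metric.isOpen_ball.measurableSet).aestronglyMeasurable ?_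
    have h1 : Integrable (fun p : ℝ × ℝ => (Ioo 0 R).indicator (fun r : ℝ => r ^ 2) p.1 • h p.2)
        polarDom := by
      refine Integrable.smul_prod (Integrable.integrableOn ?_) hi
      rw [integrable_indicator_iff measurableSet_Ioo]
      exact ((continuous_pow 2).continuousOn.integrableOn_Icc).mono_set Ioo_subset_Icc_self
    refine h1.congr ?_
    filter_upwards [ae_polarDom_pos] with p h0
    by_cases hR : p.1 < R
    · rw [indicator_of_mem (show p.1 ∈ Ioo 0 R from ⟨h0, hR⟩), indicator_of_mem, hVp p h0,
        smul_smul, pow_two]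
      simpa [norm_polar h0.le] using hR
    · rw [indicator_of_notMem (fun h' => hR h'.2), indicator_of_notMem]
      · simp
      · simpa [norm_polar h0.le] using hR
  have h1 := Metric.isOpen_ball.ae_eq_zero_of_integral_contDiff_smul_eq_zero (μ := volume)
    (U := Metric.ball (0 : Plane) R)
    (f := fun x => mulV (D x) (rot x) - (Metric.ball 0 R).indicator V x)
    ((H.integrableOn_mulV continuous_rot norm_rot).sub
      hVi.integrableOn).locallyIntegrableOn fun ψ hψ c s => ?_
  · filter_upwards [h1] with x hx hmem
    have := hx hmem
    rw [indicator_of_mem hmem, sub_eq_zero] at this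
    exact this
  · have i1 := H.integrable_smul_mulV continuous_rot hψ.continuous c
    have i2 := integrable_smul_of_compactSupport hVi hψ.continuous c
    simp_rw [smul_sub]
    rw [integral_sub i1 i2, sub_eq_zero]
    obtain ⟨j1, e1⟩ := H.integral_angular hψ c s
    have e2 : ∀ᵐ p ∂polarDom, p.1 • (ψ (polar p) • (Metric.ball 0 R).indicator V (polar p))
        = (p.1 ^ 2 * ψ (polar p)) • h p.2 := by
      filter_upwards [ae_polarDom_pos] with p h0
      by_cases hR : p.1 < R
      · rw [indicator_of_mem, hVp p h0]
        · simp only [smul_smul]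
          congr 1
          ring
        · simpa [norm_polar h0.le] using hR
      · simp [image_eq_zero_of_notMem_tsupport (notMem_tsupport_polar s h0 hR)]
    have j2 := (integrable_polar i2).congr e2
    rw [integral_polar i2.1, integral_congr_ae e2, integral_polarDom j2]
    rw [integral_polarDom j1] at e1
    rw [← neg_eq_iff_eq_neg] at e1
    rw [← e1, ← integral_neg]
    -- on each circle the restriction of `ψ` is a periodic test function
    congr 1
    ext1 r
    have hd := hw (fun θ => ψ (polar (r, θ)))
      (hψ.comp (contDiff_polar.comp (contDiff_const.prodMk contDiff_id)))
      (fun θ => by simp [polar, er_periodic θ])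
    have hd' : deriv (fun θ => ψ (polar (r, θ)))
        = fun θ => r * fderiv ℝ ψ (polar (r, θ)) (et θ) := funext fun θ =>
      (hasDerivAt_comp_polar_snd ((hψ.differentiable (by simp)) _)).deriv
    rw [hd'] at hd
    simp only [mul_smul (r ^ 2), integral_smul]
    rw [hd, smul_neg, neg_neg]

/-- In polar coordinates the weak gradient does not depend on the radius. -/
lemma ae_eq_gradPolar (H : IsLocalGrad g R D) {h : ℝ → Vec m} (hm : StronglyMeasurable h)
    (hp : Function.Periodic h (2 * Real.pi)) (hi : IntegrableOn h (Ioc 0 (2 * Real.pi)))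
    (hw : WeakDerivPer (fun θ => g (circ θ)) h) :
    ∀ᵐ p ∂polarDom, p.1 < R → D (polar p) = gradPolar g h p.2 := by
  filter_upwards [ae_polarDom_pos, quasiMeasurePreserving_polar.ae H.ae_mulV_self,
    quasiMeasurePreserving_polar.ae (H.ae_mulV_rot hm hp hi hw)] with p h0 h1 h2 hR
  have hmem : polar p ∈ Metric.ball (0 : Plane) R := by simpa [norm_polar h0.le] using hR
  have e1 := h1 hmem
  have e2 := h2 hmem
  rw [oneHom_polar g h0] at e1
  conv_lhs at e1 => enter [2]; rw [polar]
  rw [mulV_smul_right] at e1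
  rw [rot_polar, mulV_smul_right, norm_polar h0.le, angle_polar h0 hp] at e2
  rw [eq_dyad_add_dyad (D (polar p)) p.2, smul_right_injective _ h0.ne' e1,
    smul_right_injective _ h0.ne' e2, gradPolar]

/-- The gradient is square integrable on the circle. -/
lemma integrableOn_sq_gradPolar (H : IsLocalGrad g R D) {h : ℝ → Vec m}
    (hm : StronglyMeasurable h)
    (hp : Function.Periodic h (2 * Real.pi)) (hi : IntegrableOn h (Ioc 0 (2 * Real.pi)))
    (hw : WeakDerivPer (fun θ => g (circ θ)) h) :
    IntegrableOn (fun θ => ‖gradPolar g h θ‖ ^ 2) (Ioc 0 (2 * Real.pi)) := by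
  have h1 : ∀ᵐ r ∂volume.restrict (Ioi 0), IntegrableOn
      (fun θ => r • ‖D (polar (r, θ))‖ ^ 2) (Ioc 0 (2 * Real.pi)) :=
    (integrable_polar H.sq).prod_right_ae
  have h2 : ∀ᵐ r ∂volume.restrict (Ioi 0), ∀ᵐ θ ∂volume.restrict (Ioc 0 (2 * Real.pi)),
      r < R → D (polar (r, θ)) = gradPolar g h θ :=
    Measure.ae_ae_of_ae_prod (H.ae_eq_gradPolar hm hp hi hw)
  obtain ⟨r, hr, hrR, h3, h4⟩ := exists_radius H.pos (h1.and h2)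
  refine (h3.smul r⁻¹).congr ?_
  filter_upwards [h4] with θ hθ
  simp only [Pi.smul_apply]
  rw [hθ hrR, smul_smul, inv_mul_cancel₀ hr.ne', one_smul]

end IsLocalGrad

end

/-! ### Blow-up at the origin -/

section

variable {m : ℕ}

/-- `∫ s η'(s) ds = - ∫ η(s) ds`. -/
lemma integral_mul_deriv_bump {η : ℝ → ℝ} (hη : ContDiff ℝ ∞ η) (hc : HasCompactSupport η) :
    ∫ s in Ioi 0, s * deriv η s = - ∫ s in Ioi 0, η s := by
  have hd : ∀ s, HasDerivAt (fun s => s * η s) (η s + s * deriv η s) s := fun s => by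
    simpa using (hasDerivAt_id s).fun_mul ((hη.differentiable (by simp)) s).hasDerivAt
  have h1 : ContDiff ℝ 1 fun s => s * η s := contDiff_id.mul (hη.of_le (by simp))
  have h2 := (hc.mul_left (f := fun s => s)).integral_Ioi_deriv_eq h1 0
  rw [show deriv (fun s => s * η s) = _ from funext fun s => (hd s).deriv, integral_add] at h2
  · rw [eq_neg_iff_add_eq_zero, add_comm, h2]
    simp
  · exact (hη.continuous.integrable_of_hasCompactSupport hc).integrableOn
  · exact ((continuous_id.mul (hη.continuous_deriv (by simp))).integrable_of_hasCompactSupport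
      hc.deriv.mul_left).integrableOn

/-- Blowing up at the origin turns the equation into an ordinary differential equation on the
circle: if `B(x, D)` is divergence free near `0`, where `D` is the zero-homogeneous field with
angular profile `G`, then `(B(0, G) e_θ)' = - B(0, G) e_r` weakly. -/
lemma weakDerivPer_of_divergence_free {B : Plane → Mat m → Mat m}
    (hB : Continuous fun z : Plane × Mat m => B z.1 z.2) {K : ℝ}
    (hK : ∀ x F, ‖B x F‖ ≤ K * (1 + ‖F‖ ^ 2)) {R : ℝ} (hR : 0 < R) {D : Plane → Mat m}
    {G : ℝ → Mat m} (hG : AEStronglyMeasurable G (volume.restrict (Ioc 0 (2 * Real.pi))))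
    (hG2 : IntegrableOn (fun θ => ‖G θ‖ ^ 2) (Ioc 0 (2 * Real.pi)))
    (hDG : ∀ᵐ p ∂polarDom, p.1 < R → D (polar p) = G p.2)
    (hsol : ∀ ψ : Plane → ℝ, ContDiff ℝ ∞ ψ → HasCompactSupport ψ →
      tsupport ψ ⊆ Metric.ball 0 R → Integrable (fun x => mulV (B x (D x)) (gradV ψ x)) ∧
        ∫ x, mulV (B x (D x)) (gradV ψ x) = 0) :
    WeakDerivPer (fun θ => mulV (B 0 (G θ)) (et θ)) (fun θ => -mulV (B 0 (G θ)) (er θ)) := by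
  intro χ hχ hper
  obtain ⟨η, hη, ηc, ηs, ηpos⟩ := exists_bump hR
  have hη' : Continuous (deriv η) := hη.continuous_deriv (by simp)
  have hη0 : Continuous η := hη.continuous
  have hχ0 : Continuous χ := hχ.continuous
  have hχ' : Continuous (deriv χ) := hχ.continuous_deriv (by simp)
  have hK0 : 0 ≤ K := by
    have := (norm_nonneg _).trans (hK 0 0)
    simpa using this
  -- the equation tested with `η(|x| / ε) χ(arg x)`, in the rescaled variables `(|x| / ε, arg x)`
  set Φ : ℝ → ℝ × ℝ → Vec m := fun ε p =>
    (p.1 * deriv η p.1 * χ p.2) • mulV (B (polar (ε * p.1, p.2)) (G p.2)) (er p.2)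
      + (η p.1 * deriv χ p.2) • mulV (B (polar (ε * p.1, p.2)) (G p.2)) (et p.2) with hΦ
  have hGs : AEStronglyMeasurable (fun p : ℝ × ℝ => G p.2) polarDom := hG.comp_snd
  have hBm : ∀ ε : ℝ, AEStronglyMeasurable
      (fun p : ℝ × ℝ => B (polar (ε * p.1, p.2)) (G p.2)) polarDom := fun ε =>
    hB.comp_aestronglyMeasurable ((Continuous.aestronglyMeasurable
      (continuous_polar.comp (by fun_prop))).prodMk hGs)
  have hΦm : ∀ ε, AEStronglyMeasurable (Φ ε) polarDom := fun ε => by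
    refine AEStronglyMeasurable.add ?_ ?_
    · have hc : Continuous fun p : ℝ × ℝ => p.1 * deriv η p.1 * χ p.2 := by fun_prop
      exact hc.aestronglyMeasurable.smul
        (continuous_mulV.comp_aestronglyMeasurable ((hBm ε).prodMk
          (continuous_er.comp continuous_snd).aestronglyMeasurable))
    · have hc : Continuous fun p : ℝ × ℝ => η p.1 * deriv χ p.2 := by fun_prop
      exact hc.aestronglyMeasurable.smul
        (continuous_mulV.comp_aestronglyMeasurable ((hBm ε).prodMk
          (continuous_et.comp continuous_snd).aestronglyMeasurable))
  obtain ⟨L, hL⟩ := (isCompact_Icc (a := (0 : ℝ)) (b := 2 * Real.pi)).exists_bound_of_continuousOn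
    (f := fun θ => |χ θ| + |deriv χ θ|) (by fun_prop)
  set bd : ℝ × ℝ → ℝ := fun p =>
    (|p.1 * deriv η p.1| + |η p.1|) * (L * (K * (1 + ‖G p.2‖ ^ 2))) with hbd
  have hbdi : Integrable bd polarDom := by
    refine Integrable.mul_prod (μ := volume.restrict (Ioi 0))
      (ν := volume.restrict (Ioc 0 (2 * Real.pi))) (f := fun s => |s * deriv η s| + |η s|)
      (g := fun θ => L * (K * (1 + ‖G θ‖ ^ 2))) ?_ ?_
    · refine (Continuous.integrable_of_hasCompactSupport (by fun_prop) ?_).integrableOn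
      exact (ηc.deriv.mul_left (f := fun s => s)).norm.add ηc.norm
    · exact (((integrable_const 1).add hG2).const_mul K).const_mul L
  have hmem : ∀ᵐ p ∂polarDom, p.2 ∈ Ioc 0 (2 * Real.pi) :=
    Measure.quasiMeasurePreserving_snd.ae (ae_restrict_mem measurableSet_Ioc)
  have hΦb : ∀ ε, ∀ᵐ p ∂polarDom, ‖Φ ε p‖ ≤ bd p := fun ε => by
    filter_upwards [hmem] with p hp
    have hLp := hL p.2 (Ioc_subset_Icc_self hp)
    rw [Real.norm_eq_abs, abs_of_nonneg (by positivity)] at hLp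
    set Z := B (polar (ε * p.1, p.2)) (G p.2) with hZ
    have hZK : ‖Z‖ ≤ K * (1 + ‖G p.2‖ ^ 2) := hK _ _
    have h1 : ‖mulV Z (er p.2)‖ ≤ ‖Z‖ := by simpa [norm_er] using norm_mulV_le Z (er p.2)
    have h2 : ‖mulV Z (et p.2)‖ ≤ ‖Z‖ := by simpa [norm_et] using norm_mulV_le Z (et p.2)
    have h3 : |χ p.2| ≤ L := by linarith [abs_nonneg (deriv χ p.2)]
    have h4 : |deriv χ p.2| ≤ L := by linarith [abs_nonneg (χ p.2)]
    have hL0 : 0 ≤ L := (abs_nonneg _).trans h3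
    calc ‖Φ ε p‖ ≤ |p.1 * deriv η p.1| * |χ p.2| * ‖mulV Z (er p.2)‖
          + |η p.1| * |deriv χ p.2| * ‖mulV Z (et p.2)‖ := by
          refine (norm_add_le _ _).trans (le_of_eq ?_)
          rw [norm_smul, norm_smul, Real.norm_eq_abs, Real.norm_eq_abs, abs_mul _ (χ p.2),
            abs_mul _ (deriv χ p.2)]
      _ ≤ |p.1 * deriv η p.1| * L * (K * (1 + ‖G p.2‖ ^ 2))
          + |η p.1| * L * (K * (1 + ‖G p.2‖ ^ 2)) := by
          gcongr
          · exact h1.trans hZK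
          · exact h2.trans hZK
      _ = bd p := by rw [hbd]; ring
  have hΦi : ∀ ε, Integrable (Φ ε) polarDom := fun ε => hbdi.mono' (hΦm ε) (hΦb ε)
  have hzero : ∀ n : ℕ, ∫ p, Φ ((n : ℝ) + 1)⁻¹ p ∂polarDom = 0 := by
    intro n
    -- `a = 1 / ε ≥ 1`, so that `η(a |x|)` is still supported in the ball
    set a : ℝ := (n : ℝ) + 1 with ha
    have ha1 : 1 ≤ a := by simp [ha]
    have ha0 : 0 < a := by linarith
    set ηa : ℝ → ℝ := fun r => η (a * r) with hηa
    have sηa : tsupport ηa ⊆ {r | a * r ∈ tsupport η} :=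
      closure_minimal (fun r hr => subset_tsupport η hr)
        ((isClosed_tsupport η).preimage (continuous_const.mul continuous_id))
    have sηa' : tsupport ηa ⊆ Ioo 0 R := fun r hr => by
      obtain ⟨h1, h2⟩ := ηs (sηa hr)
      have hr0 : 0 < r := pos_of_mul_pos_right h1 ha0.le
      refine ⟨hr0, lt_of_le_of_lt ?_ h2⟩
      nlinarith
    have dηa : ∀ r, deriv ηa r = a * deriv η (a * r) := fun r => by
      have := deriv_comp_mul_left a η r
      simpa using this
    have cηa : HasCompactSupport ηa :=
      HasCompactSupport.of_support_subset_isCompact (isCompact_Icc (a := 0) (b := R))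
        fun r hr => Ioo_subset_Icc_self (sηa' (subset_tsupport _ hr))
    have smηa : ContDiff ℝ ∞ ηa := hη.comp (contDiff_const.mul contDiff_id)
    have pηa : tsupport ηa ⊆ Ioi 0 := fun r hr => (sηa' hr).1
    obtain ⟨hWi, hW0⟩ := hsol (sep ηa χ) (contDiff_sep smηa pηa hχ hper)
      (hasCompactSupport_sep χ cηa) fun x hx => by
        have := sηa' (tsupport_sep_subset ηa χ hx)
        simpa using this.2
    have he : ∀ᵐ p ∂polarDom, p.1 • mulV (B (polar p) (D (polar p))) (gradV (sep ηa χ) (polar p))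
        = Φ a⁻¹ (a * p.1, p.2) := by
      filter_upwards [ae_polarDom_pos, hDG] with p h0 hp
      simp only [hΦ]
      rw [show a⁻¹ * (a * p.1) = p.1 by field_simp]
      by_cases hpR : p.1 < R
      · rw [hp hpR, mulV_gradV _ _ _ p.2, smul_add, smul_smul, smul_smul,
          fderiv_sep_er smηa pηa hχ hper h0, fderiv_sep_et smηa pηa hχ hper h0, dηa]
        congr 2
        ring
      · have hn : p.1 ∉ tsupport ηa := fun h => hpR (sηa' h).2
        have hn' : polar p ∉ tsupport (sep ηa χ) := fun h => hn (by
          have := tsupport_sep_subset ηa χ h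
          rwa [mem_ofPred_eq, norm_polar h0.le] at this)
        have e1 : η (a * p.1) = 0 := image_eq_zero_of_notMem_tsupport (f := ηa) hn
        have e2 : deriv η (a * p.1) = 0 := by
          have : deriv ηa p.1 = 0 :=
            image_eq_zero_of_notMem_tsupport fun h => hn (tsupport_deriv_subset h)
          rw [dηa] at this
          exact (mul_eq_zero.1 this).resolve_left ha0.ne'
        rw [mulV_gradV _ _ _ p.2, fderiv_eq_zero_of_notMem_tsupport hn', e1, e2]
        simp
    rw [integral_polar hWi.1, integral_congr_ae he,
      integral_polarDom_symm ((integrable_polar hWi).congr he)] at hW0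
    have hs : ∀ θ, ∫ r in Ioi 0, Φ a⁻¹ (a * r, θ) = a⁻¹ • ∫ s in Ioi 0, Φ a⁻¹ (s, θ) := fun θ => by
      have := integral_comp_mul_left_Ioi (fun s => Φ a⁻¹ (s, θ)) 0 ha0
      rwa [mul_zero] at this
    simp only [hs, integral_smul] at hW0
    rw [integral_polarDom_symm (hΦi _)]
    exact (smul_eq_zero.1 hW0).resolve_left (inv_ne_zero ha0.ne')
  have hlim : Filter.Tendsto (fun n : ℕ => ∫ p, Φ ((n : ℝ) + 1)⁻¹ p ∂polarDom) Filter.atTop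
      (nhds (∫ p, Φ 0 p ∂polarDom)) := by
    refine tendsto_integral_of_dominated_convergence bd (fun n => hΦm _) hbdi
      (fun n => hΦb _) (Filter.Eventually.of_forall fun p => ?_)
    have hc : Continuous fun ε : ℝ => Φ ε p := by
      have h1 : Continuous fun ε : ℝ => B (polar (ε * p.1, p.2)) (G p.2) :=
        hB.comp ((continuous_polar.comp (by fun_prop)).prodMk continuous_const)
      have h2 : ∀ b : Plane, Continuous fun ε : ℝ => mulV (B (polar (ε * p.1, p.2)) (G p.2)) b :=
        fun b => continuous_mulV.comp (h1.prodMk continuous_const)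
      exact ((h2 _).const_smul (p.1 * deriv η p.1 * χ p.2)).add
        ((h2 _).const_smul (η p.1 * deriv χ p.2))
    have ht : Filter.Tendsto (fun n : ℕ => ((n : ℝ) + 1)⁻¹) Filter.atTop (nhds 0) := by
      simpa using tendsto_one_div_add_atTop_nhds_zero_nat (𝕜 := ℝ)
    exact (hc.tendsto 0).comp ht
  have hfin : ∫ p, Φ 0 p ∂polarDom = 0 := by
    simp only [hzero] at hlim
    exact tendsto_nhds_unique hlim tendsto_const_nhds
  have hB0 : IntegrableOn (fun θ => B 0 (G θ)) (Ioc 0 (2 * Real.pi)) := by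
    refine Integrable.mono' (((integrable_const 1).add hG2).const_mul K) ?_
      (Filter.Eventually.of_forall fun θ => hK 0 _)
    exact hB.comp_aestronglyMeasurable (aestronglyMeasurable_const.prodMk hG)
  have hBb : ∀ {e : ℝ → Plane}, Continuous e → (∀ θ, ‖e θ‖ = 1) →
      IntegrableOn (fun θ => mulV (B 0 (G θ)) (e θ)) (Ioc 0 (2 * Real.pi)) := fun {e} he hn => by
    refine Integrable.mono' hB0.norm ?_ (Filter.Eventually.of_forall fun θ => ?_)
    · exact continuous_mulV.comp_aestronglyMeasurable (hB0.1.prodMk he.aestronglyMeasurable)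
    · simpa [hn] using norm_mulV_le (B 0 (G θ)) (e θ)
  have i1 : Integrable (fun p : ℝ × ℝ => (p.1 * deriv η p.1) •
      (χ p.2 • mulV (B 0 (G p.2)) (er p.2))) polarDom :=
    Integrable.smul_prod (μ := volume.restrict (Ioi 0))
      (f := fun s => s * deriv η s) ((Continuous.integrable_of_hasCompactSupport (by fun_prop)
        ηc.deriv.mul_left).integrableOn)
      (integrableOn_smul_of_continuous hχ.continuous (hBb continuous_er norm_er))
  have i2 : Integrable (fun p : ℝ × ℝ => η p.1 •
      (deriv χ p.2 • mulV (B 0 (G p.2)) (et p.2))) polarDom :=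
    Integrable.smul_prod (μ := volume.restrict (Ioi 0))
      ((hη.continuous.integrable_of_hasCompactSupport ηc).integrableOn)
      (integrableOn_smul_of_continuous hχ' (hBb continuous_et norm_et))
  have hsplit : Φ 0 = fun p => (p.1 * deriv η p.1) • (χ p.2 • mulV (B 0 (G p.2)) (er p.2))
      + η p.1 • (deriv χ p.2 • mulV (B 0 (G p.2)) (et p.2)) := by
    ext1 p
    simp [hΦ, polar, smul_smul]
  rw [hsplit, integral_add i1 i2] at hfin
  have e1 := integral_prod_smul (μ := volume.restrict (Ioi 0))
    (ν := volume.restrict (Ioc 0 (2 * Real.pi))) (fun s => s * deriv η s)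
    (fun θ => χ θ • mulV (B 0 (G θ)) (er θ))
  have e2 := integral_prod_smul (μ := volume.restrict (Ioi 0))
    (ν := volume.restrict (Ioc 0 (2 * Real.pi))) η
    (fun θ => deriv χ θ • mulV (B 0 (G θ)) (et θ))
  rw [polarDom, e1, e2, integral_mul_deriv_bump hη ηc, neg_smul, neg_add_eq_zero] at hfin
  have hpos := ηpos 0
  simp only [pow_zero, one_mul] at hpos
  have := smul_right_injective (Vec m) hpos.ne' hfin
  simp only [smul_neg, integral_neg, neg_neg]
  exact this.symm

end

/-! ### The coefficients and the localized equation -/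

section

variable {m : ℕ}

section Coefficient

variable {Ω : Set Plane} {A : Plane → Mat m → Mat m} {C ν : ℝ}

lemma contDiff_coeff (hΩ : IsOpen Ω)
    (hA : ContDiffOn ℝ 1 (fun z : Plane × Mat m => A z.1 z.2) (Ω ×ˢ (univ : Set (Mat m))))
    {x : Plane} (hx : x ∈ Ω) : ContDiff ℝ 1 (A x) := by
  rw [contDiff_iff_contDiffAt]
  intro F
  have h1 : ContDiffAt ℝ 1 (fun z : Plane × Mat m => A z.1 z.2) (x, F) :=
    hA.contDiffAt ((hΩ.prod isOpen_univ).mem_nhds ⟨hx, mem_univ F⟩)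
  exact h1.comp F (contDiffAt_const.prodMk contDiffAt_id)

/-- Linear growth of the derivative gives a Lipschitz bound on balls. -/
lemma norm_sub_le_of_growth {a : Mat m → Mat m} (ha : ContDiff ℝ 1 a)
    (hC : 0 ≤ C) (hgrowth : ∀ F, ‖fderiv ℝ a F‖ ≤ C * (1 + ‖F‖)) {ρ : ℝ} {F G : Mat m}
    (hF : ‖F‖ ≤ ρ) (hG : ‖G‖ ≤ ρ) : ‖a F - a G‖ ≤ C * (1 + ρ) * ‖F - G‖ := by
  refine Convex.norm_image_sub_le_of_norm_fderiv_le (𝕜 := ℝ) (s := Metric.closedBall 0 ρ)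
    (fun H _ => (ha.differentiable (by simp)) H) (fun H hH => (hgrowth H).trans ?_)
    (convex_closedBall 0 ρ) (by simpa using hG) (by simpa using hF)
  have : ‖H‖ ≤ ρ := by simpa using hH
  gcongr

/-- Rank-one ellipticity, integrated along a rank-one segment. -/
lemma rankOne_monotone {a : Mat m → Mat m} (ha : ContDiff ℝ 1 a)
    (hell : ∀ (F : Mat m) (p : Vec m) (b : Plane),
      ν * ‖p‖ ^ 2 * ‖b‖ ^ 2 ≤ inner ℝ (fderiv ℝ a F (dyad p b)) (dyad p b))
    (F : Mat m) (p : Vec m) {b : Plane} (hb : ‖b‖ = 1) :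
    ν * ‖p‖ ^ 2 ≤ inner ℝ (mulV (a (F + dyad p b)) b - mulV (a F) b) p := by
  have hd : ∀ t : ℝ, HasDerivAt (fun t : ℝ => inner ℝ (a (F + t • dyad p b)) (dyad p b))
      (inner ℝ (fderiv ℝ a (F + t • dyad p b) (dyad p b)) (dyad p b)) t := fun t => by
    have h1 : HasDerivAt (fun t : ℝ => F + t • dyad p b) (dyad p b) t := by
      simpa using ((hasDerivAt_id t).smul_const (dyad p b)).const_add F
    have h2 := ((ha.differentiable (by simp)) (F + t • dyad p b)).hasFDerivAt.comp_hasDerivAt t h1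
    simpa using h2.inner ℝ (hasDerivAt_const t (dyad p b))
  have h := mul_sub_le_image_sub_of_le_deriv (C := ν * ‖p‖ ^ 2)
    (fun t => (hd t).differentiableAt) (fun t => by
      rw [(hd t).deriv]
      simpa [hb] using hell (F + t • dyad p b) p b) zero_le_one
  rw [← mulV_sub, ← inner_dyad, inner_sub_left]
  simpa using h

/-- The radial retraction of the plane onto the closed ball of radius `R`. Composed with it, the
coefficient `A`, controlled only on `Ω`, becomes continuous everywhere. -/
def retract (R : ℝ) (x : Plane) : Plane := (R / max R ‖x‖) • x

lemma retract_of_mem {R : ℝ} (hR : 0 < R) {x : Plane} (hx : ‖x‖ ≤ R) : retract R x = x := by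
  rw [retract, max_eq_left hx, div_self hR.ne', one_smul]

lemma norm_retract_le {R : ℝ} (hR : 0 < R) (x : Plane) : ‖retract R x‖ ≤ R := by
  have h : 0 < max R ‖x‖ := lt_max_of_lt_left hR
  rw [retract, norm_smul, Real.norm_eq_abs, abs_of_pos (div_pos hR h), div_mul_eq_mul_div,
    div_le_iff₀ h]
  exact mul_le_mul_of_nonneg_left (le_max_right _ _) hR.le

lemma continuous_retract {R : ℝ} (hR : 0 < R) : Continuous (retract R) := by
  unfold retract
  refine Continuous.smul
    (continuous_const.div (continuous_const.max continuous_norm) fun x => ?_) continuous_id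
  exact (lt_max_of_lt_left hR).ne'

lemma continuous_coeff_retract
    (hA : ContDiffOn ℝ 1 (fun z : Plane × Mat m => A z.1 z.2) (Ω ×ˢ (univ : Set (Mat m))))
    {R : ℝ} (hR : 0 < R) (hRΩ : Metric.closedBall 0 R ⊆ Ω) :
    Continuous fun z : Plane × Mat m => A (retract R z.1) z.2 := by
  refine hA.continuousOn.comp_continuous (f := fun z : Plane × Mat m => (retract R z.1, z.2))
    (((continuous_retract hR).comp continuous_fst).prodMk continuous_snd) fun z => ⟨hRΩ ?_, trivial⟩
  simpa using norm_retract_le hR z.1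

lemma exists_bound_coeff_retract (hΩ : IsOpen Ω)
    (hA : ContDiffOn ℝ 1 (fun z : Plane × Mat m => A z.1 z.2) (Ω ×ˢ (univ : Set (Mat m))))
    (hC : 0 < C) (hgrowth : ∀ x ∈ Ω, ∀ F : Mat m, ‖fderiv ℝ (A x) F‖ ≤ C * (1 + ‖F‖))
    {R : ℝ} (hR : 0 < R) (hRΩ : Metric.closedBall 0 R ⊆ Ω) :
    ∃ K, ∀ x F, ‖A (retract R x) F‖ ≤ K * (1 + ‖F‖ ^ 2) := by
  obtain ⟨M, hM⟩ := (isCompact_closedBall (0 : Plane) R).exists_bound_of_continuousOn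
    (f := fun x => A (retract R x) 0)
    ((continuous_coeff_retract hA hR hRΩ).comp
      (continuous_id.prodMk continuous_const)).continuousOn
  refine ⟨M + 2 * C, fun x F => ?_⟩
  have hmem : retract R x ∈ Metric.closedBall (0 : Plane) R := by
    simpa using norm_retract_le hR x
  have h1 := hM _ hmem
  rw [retract_of_mem hR (norm_retract_le hR x)] at h1
  have hM0 := (norm_nonneg _).trans h1
  have h2 := norm_sub_le_of_growth (contDiff_coeff hΩ hA (hRΩ hmem)) hC.le
    (hgrowth _ (hRΩ hmem)) (le_refl ‖F‖) (G := 0) (by simp)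
  rw [sub_zero] at h2
  have h3 := norm_le_norm_add_norm_sub' (A (retract R x) F) (A (retract R x) 0)
  nlinarith [norm_nonneg F, sq_nonneg (‖F‖ - 1), mul_nonneg hM0 (sq_nonneg ‖F‖),
    mul_nonneg hC.le (sq_nonneg (‖F‖ - 1)), mul_nonneg hC.le (sq_nonneg ‖F‖)]

end Coefficient

/-- A weak gradient on an open set restricts to a weak gradient in a small ball. -/
lemma IsW12.exists_isLocalGrad {Ω : Set Plane} (hΩ : IsOpen Ω) {g : S1 → Vec m}
    {Du : Plane → Mat m} (hu : IsW12 Ω (oneHom g) Du) {R : ℝ} (hR : 0 < R)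
    (hRΩ : Metric.ball 0 R ⊆ Ω) : ∃ D, IsLocalGrad g R D ∧
      ∀ᵐ x, x ∈ Metric.ball (0 : Plane) R → D x = Du x := by
  have hms : MeasurableSet (Metric.ball (0 : Plane) R) := Metric.isOpen_ball.measurableSet
  have hle := Measure.restrict_mono hRΩ (le_refl (volume : Measure Plane))
  have h1 : MemLp Du 2 (volume.restrict (Metric.ball 0 R)) := hu.memLp_grad.mono_measure hle
  have h2 : MemLp (oneHom g) 2 (volume.restrict (Metric.ball 0 R)) := hu.memLp.mono_measure hle
  have : IsFiniteMeasure ((volume : Measure Plane).restrict (Metric.ball 0 R)) :=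
    ⟨by simpa using measure_ball_lt_top (μ := (volume : Measure Plane)) (x := 0) (r := R)⟩
  set D' := h1.1.mk Du with hD'
  have hae : Du =ᵐ[volume.restrict (Metric.ball 0 R)] D' := h1.1.ae_eq_mk
  have hae' : ∀ᵐ x, x ∈ Metric.ball (0 : Plane) R → Du x = D' x :=
    (ae_restrict_iff' hms).1 hae
  have h1' : MemLp D' 2 (volume.restrict (Metric.ball 0 R)) := h1.ae_eq hae
  refine ⟨(Metric.ball 0 R).indicator D', ⟨hR, ?_, ?_, ?_, ?_, ?_⟩, ?_⟩
  · exact h1.1.stronglyMeasurable_mk.indicator hms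
  · exact (integrable_indicator_iff hms).2 (h1'.integrable one_le_two)
  · have : (fun x => ‖(Metric.ball 0 R).indicator D' x‖ ^ 2)
        = (Metric.ball 0 R).indicator fun x => ‖D' x‖ ^ 2 := by
      ext x
      by_cases hx : x ∈ Metric.ball (0 : Plane) R <;> simp [hx]
    rw [this, integrable_indicator_iff hms]
    exact (memLp_two_iff_integrable_sq_norm h1'.1).1 h1'
  · exact (integrable_indicator_iff hms).2 (h2.integrable one_le_two)
  · intro ψ hψ c s i j
    have h0 := hu.weak_grad ψ hψ c (s.trans hRΩ) i j
    have z1 : ∀ x ∉ Metric.ball (0 : Plane) R, ψ x = 0 := fun x hx =>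
      image_eq_zero_of_notMem_tsupport fun h => hx (s h)
    have z2 : ∀ x ∉ Metric.ball (0 : Plane) R, partialD j ψ x = 0 := fun x hx => by
      rw [partialD, fderiv_eq_zero_of_notMem_tsupport fun h => hx (s h), zero_apply]
    rw [setIntegral_eq_of_subset_of_forall_sdiff_eq_zero hΩ.measurableSet hRΩ
        (fun x hx => by rw [z2 x hx.2, mul_zero]),
      setIntegral_eq_of_subset_of_forall_sdiff_eq_zero hΩ.measurableSet hRΩ
        (fun x hx => by rw [z1 x hx.2, mul_zero])] at h0
    have w1 := setIntegral_eq_integral_of_forall_compl_eq_zero (μ := volume)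
      (s := Metric.ball (0 : Plane) R)
      (f := fun x => partialD j ψ x * (Metric.ball 0 R).indicator (oneHom g) x i)
      (fun x hx => by rw [z2 x hx, zero_mul])
    have w2 := setIntegral_eq_integral_of_forall_compl_eq_zero (μ := volume)
      (s := Metric.ball (0 : Plane) R)
      (f := fun x => ψ x * (Metric.ball 0 R).indicator D' x (i, j))
      (fun x hx => by rw [z1 x hx, zero_mul])
    rw [← w1, ← w2]
    refine Eq.trans (setIntegral_congr_fun hms fun x hx => ?_) (h0.trans (congrArg Neg.neg
      (setIntegral_congr_ae hms ?_)))
    · simp only [indicator_of_mem hx, mul_comm]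
    · filter_upwards [hae'] with x hx hmem
      rw [indicator_of_mem hmem, hx hmem, mul_comm]
  · filter_upwards [hae'] with x hx hmem
    rw [indicator_of_mem hmem, hx hmem]

/-- The equation in the ball, tested with scalar functions. -/
lemma divergence_free_of_weak_solution {Ω : Set Plane} (hΩ : IsOpen Ω)
    {A : Plane → Mat m → Mat m} {Du : Plane → Mat m}
    (hsol : ∀ φ : Plane → Vec m, ContDiff ℝ 1 φ → HasCompactSupport φ → tsupport φ ⊆ Ω →
        ∫ x in Ω, inner ℝ (A x (Du x)) (gradMat φ x) = 0)
    {B : Plane → Mat m → Mat m} (hB : Continuous fun z : Plane × Mat m => B z.1 z.2) {K : ℝ}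
    (hK : ∀ x F, ‖B x F‖ ≤ K * (1 + ‖F‖ ^ 2)) {R : ℝ} (hRΩ : Metric.ball 0 R ⊆ Ω)
    (hBA : ∀ x ∈ Metric.ball (0 : Plane) R, ∀ F, B x F = A x F)
    {D : Plane → Mat m} (hDm : StronglyMeasurable D) (hD2 : Integrable fun x => ‖D x‖ ^ 2)
    (hD : ∀ᵐ x, x ∈ Metric.ball (0 : Plane) R → D x = Du x)
    {ψ : Plane → ℝ} (hψ : ContDiff ℝ ∞ ψ) (c : HasCompactSupport ψ)
    (s : tsupport ψ ⊆ Metric.ball 0 R) :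
    Integrable (fun x => mulV (B x (D x)) (gradV ψ x)) ∧
      ∫ x, mulV (B x (D x)) (gradV ψ x) = 0 := by
  have hψ1 : ContDiff ℝ 1 ψ := hψ.of_le (by simp)
  have hgc : Continuous (gradV ψ) := continuous_gradV hψ1
  have hg0 : ∀ x ∉ tsupport ψ, gradV ψ x = 0 := fun x hx => by
    ext j
    simp [partialD, fderiv_eq_zero_of_notMem_tsupport hx]
  have hgs : HasCompactSupport (gradV ψ) := HasCompactSupport.intro c.isCompact hg0
  have hBm : StronglyMeasurable fun x => B x (D x) :=
    hB.comp_stronglyMeasurable (stronglyMeasurable_id.prodMk hDm)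
  have hi : Integrable fun x => mulV (B x (D x)) (gradV ψ x) := by
    have i1 : Integrable fun x => ‖gradV ψ x‖ :=
      (hgc.integrable_of_hasCompactSupport hgs).norm
    obtain ⟨L, hL⟩ := hgs.exists_bound_of_continuous hgc
    refine Integrable.mono' ((i1.add (hD2.const_mul L)).const_mul K)
      (continuous_mulV.comp_stronglyMeasurable
        (hBm.prodMk hgc.stronglyMeasurable)).aestronglyMeasurable
      (Filter.Eventually.of_forall fun x => ?_)
    have hK0 : 0 ≤ K := by simpa using (norm_nonneg _).trans (hK 0 0)
    calc ‖mulV (B x (D x)) (gradV ψ x)‖ ≤ K * (1 + ‖D x‖ ^ 2) * ‖gradV ψ x‖ :=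
          (norm_mulV_le _ _).trans (mul_le_mul_of_nonneg_right (hK _ _) (norm_nonneg _))
      _ = K * (‖gradV ψ x‖ + ‖gradV ψ x‖ * ‖D x‖ ^ 2) := by ring
      _ ≤ K * (‖gradV ψ x‖ + L * ‖D x‖ ^ 2) := by
          gcongr
          exact hL x
  refine ⟨hi, ?_⟩
  refine ext_inner_right ℝ fun v => ?_
  rw [inner_zero_left, real_inner_comm, ← integral_inner hi]
  have hcs : HasCompactSupport fun x => ψ x • v :=
    HasCompactSupport.intro c.isCompact fun x hx => by
      rw [image_eq_zero_of_notMem_tsupport hx, zero_smul]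
  have hts : tsupport (fun x => ψ x • v) ⊆ tsupport ψ :=
    closure_minimal (fun x hx => subset_tsupport ψ fun h => hx (by simp [h]))
      (isClosed_tsupport ψ)
  have h0 := hsol (fun x => ψ x • v) (hψ1.smul contDiff_const) hcs
    (hts.trans (s.trans hRΩ))
  simp only [gradMat_smul_const ((hψ.differentiable (by simp)) _), inner_dyad] at h0
  have hz : ∀ (F : Mat m), ∀ x ∉ Metric.ball (0 : Plane) R,
      inner ℝ (mulV F (gradV ψ x)) v = 0 := fun F x hx => by
    have : mulV F 0 = 0 := by ext i; simp
    rw [hg0 x fun h => hx (s h), this, inner_zero_left]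
  rw [setIntegral_eq_of_subset_of_forall_sdiff_eq_zero hΩ.measurableSet hRΩ
    fun x hx => hz _ x hx.2] at h0
  simp only [real_inner_comm _ v]
  rw [← setIntegral_eq_integral_of_forall_compl_eq_zero (s := Metric.ball (0 : Plane) R)
    fun x hx => hz _ x hx, ← h0]
  refine setIntegral_congr_ae Metric.isOpen_ball.measurableSet ?_
  filter_upwards [hD] with x hx hmem
  rw [hBA x hmem, hx hmem]

end

/-! ### Regularity for the equation on the circle -/

section

variable {m : ℕ}

lemma norm_er_sub_le (s t : ℝ) : ‖er s - er t‖ ≤ |s - t| := by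
  have := Convex.norm_image_sub_le_of_norm_hasDerivWithin_le (f := er) (s := univ) (C := 1)
    (fun θ _ => (hasDerivAt_er θ).hasDerivWithinAt) (fun θ _ => (norm_et θ).le) convex_univ
    (mem_univ t) (mem_univ s)
  simpa using this

lemma norm_et_sub_le (s t : ℝ) : ‖et s - et t‖ ≤ |s - t| := by
  have := Convex.norm_image_sub_le_of_norm_hasDerivWithin_le (f := et) (s := univ) (C := 1)
    (fun θ _ => (hasDerivAt_et θ).hasDerivWithinAt)
    (fun θ _ => by rw [norm_neg, norm_er]) convex_univ (mem_univ t) (mem_univ s)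
  simpa using this

/-- A periodic function with an integrable weak derivative is essentially bounded. -/
lemma WeakDerivPer.exists_ae_bound {f f₁ : ℝ → Vec m} (h : WeakDerivPer f f₁)
    (hp : Function.Periodic f (2 * Real.pi)) (hp₁ : Function.Periodic f₁ (2 * Real.pi))
    (hf : IntegrableOn f (Ioc 0 (2 * Real.pi))) (hf₁ : IntegrableOn f₁ (Ioc 0 (2 * Real.pi))) :
    ∃ K, ∀ᵐ θ : ℝ, ‖f θ‖ ≤ K := by
  obtain ⟨c, hc⟩ := h.exists_primitive hp hp₁ hf hf₁
  have hcont : Continuous fun θ => c + ∫ t in 0..θ, f₁ t :=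
    continuous_const.add
      (intervalIntegral.continuous_primitive (intervalIntegrable_of_periodic hp₁ hf₁) 0)
  obtain ⟨K, hK⟩ := (isCompact_Icc (a := (0 : ℝ)) (b := 2 * Real.pi)).exists_bound_of_continuousOn
    hcont.continuousOn
  refine ⟨K, ae_of_periodic (fun θ => by rw [hp]) ?_⟩
  filter_upwards [ae_restrict_of_ae hc, ae_restrict_mem measurableSet_Ioc] with θ h1 h2
  rw [h1]
  exact hK θ (Ioc_subset_Icc_self h2)

/-- A periodic function with an essentially bounded weak derivative is Lipschitz off a null set. -/
lemma WeakDerivPer.exists_lipschitz {f f₁ : ℝ → Vec m} (h : WeakDerivPer f f₁)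
    (hp : Function.Periodic f (2 * Real.pi)) (hp₁ : Function.Periodic f₁ (2 * Real.pi))
    (hf : IntegrableOn f (Ioc 0 (2 * Real.pi))) (hf₁ : IntegrableOn f₁ (Ioc 0 (2 * Real.pi)))
    {K : ℝ} (hK : ∀ᵐ θ : ℝ, ‖f₁ θ‖ ≤ K) :
    ∃ N : Set ℝ, (∀ᵐ θ : ℝ, θ ∈ N) ∧ ∀ s ∈ N, ∀ t ∈ N, ‖f s - f t‖ ≤ K * |s - t| := by
  obtain ⟨c, hc⟩ := h.exists_primitive hp hp₁ hf hf₁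
  have hii := intervalIntegrable_of_periodic hp₁ hf₁
  refine ⟨{θ | f θ = c + ∫ t in 0..θ, f₁ t}, hc, fun s hs t ht => ?_⟩
  rw [mem_ofPred_eq] at hs ht
  rw [hs, ht, add_sub_add_left_eq_sub, intervalIntegral.integral_interval_sub_left (hii _ _)
    (hii _ _)]
  exact intervalIntegral.norm_integral_le_of_norm_le_const_ae (hK.mono fun θ h _ => h)

/-- A periodic function which is Lipschitz off a null set has a periodic Lipschitz
representative. -/
lemma exists_lipschitz_representative {h : ℝ → Vec m} (hp : Function.Periodic h (2 * Real.pi))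
    {N : Set ℝ} (hN : ∀ᵐ θ : ℝ, θ ∈ N) {K : ℝ}
    (hK : ∀ s ∈ N, ∀ t ∈ N, ‖h s - h t‖ ≤ K * |s - t|) :
    ∃ (f : ℝ → Vec m) (L : NNReal), LipschitzWith L f ∧ Function.Periodic f (2 * Real.pi) ∧
      ∀ᵐ θ : ℝ, h θ = f θ := by
  have hl : LipschitzOnWith K.toNNReal h N := LipschitzOnWith.of_dist_le_mul fun s hs t ht => by
    rw [dist_eq_norm, Real.dist_eq]
    exact (hK s hs t ht).trans
      (mul_le_mul_of_nonneg_right (Real.le_coe_toNNReal K) (abs_nonneg _))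
  obtain ⟨f, hf, hfN⟩ := hl.extend_finite_dimension
  have hae : ∀ᵐ θ : ℝ, h θ = f θ := hN.mono fun θ hθ => hfN hθ
  refine ⟨f, _, hf, ?_, hae⟩
  have hshift : ∀ᵐ θ : ℝ, h (θ + 2 * Real.pi) = f (θ + 2 * Real.pi) :=
    (measurePreserving_add_right volume (2 * Real.pi)).quasiMeasurePreserving.ae hae
  have heq : (fun θ => f (θ + 2 * Real.pi)) =ᵐ[volume] f := by
    filter_upwards [hae, hshift] with θ h1 h2
    rw [← h2, hp, h1]
  have hc : Continuous f := hf.continuous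
  exact congrFun ((Continuous.ae_eq_iff_eq volume (hc.comp (by fun_prop)) hc).1 heq)

/-- A periodic Lipschitz function is weakly differentiable, with its pointwise derivative as weak
derivative. -/
lemma weakDerivPer_of_lipschitz {f : ℝ → Vec m} {L : NNReal} (hf : LipschitzWith L f)
    (hp : Function.Periodic f (2 * Real.pi)) : WeakDerivPer f (deriv f) := by
  refine weakDerivPer_of_absolutelyContinuous (fun i => ?_) ?_ ?_ hp.eq.symm fun i => ?_
  · have h1 : LipschitzWith (1 * L) fun θ => f θ i := by
      refine LipschitzWith.comp (g := f) (f := fun v : Vec m => v i) ?_ hf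
      exact LipschitzWith.of_dist_le_mul fun v w => by
        rw [NNReal.coe_one, one_mul, dist_eq_norm, dist_eq_norm]
        exact PiLp.norm_apply_le (v - w) i
    exact h1.lipschitzOnWith.absolutelyContinuousOnInterval
  · exact hf.continuous.continuousOn.integrableOn_Icc.mono_set Ioc_subset_Icc_self
  · exact Integrable.mono' (integrable_const (L : ℝ))
      (stronglyMeasurable_deriv f).aestronglyMeasurable
      (Filter.Eventually.of_forall fun θ => norm_deriv_le_of_lipschitz hf)
  · filter_upwards [hf.ae_differentiableAt_real] with θ hθ _
    exact ((EuclideanSpace.proj (𝕜 := ℝ) i : Vec m →L[ℝ] ℝ).hasFDerivAt.comp_hasDerivAt θ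
      hθ.hasDerivAt).deriv

/-- The ordinary differential equation `(a(G) e_θ)' = - a(G) e_r` for
`G = g ⊗ e_r + h ⊗ e_θ`, `h = g'`, forces `h` to be Lipschitz: rank-one monotonicity of `a` controls
`h` by `a(G) e_θ`, `g` and the angle. -/
lemma exists_lipschitz_derivative {a : Mat m → Mat m} {C ν : ℝ} (hC : 0 < C) (hν : 0 < ν)
    (hlip : ∀ {ρ : ℝ} {F G : Mat m}, ‖F‖ ≤ ρ → ‖G‖ ≤ ρ → ‖a F - a G‖ ≤ C * (1 + ρ) * ‖F - G‖)
    (hmono : ∀ (F : Mat m) (p : Vec m) {b : Plane}, ‖b‖ = 1 →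
      ν * ‖p‖ ^ 2 ≤ inner ℝ (mulV (a (F + dyad p b)) b - mulV (a F) b) p)
    {g : S1 → Vec m} {h : ℝ → Vec m} (hp : Function.Periodic h (2 * Real.pi))
    (hgi : IntegrableOn (fun θ => g (circ θ)) (Ioc 0 (2 * Real.pi)))
    (hi : IntegrableOn h (Ioc 0 (2 * Real.pi)))
    (hw : WeakDerivPer (fun θ => g (circ θ)) h)
    (hai : IntegrableOn (fun θ => a (gradPolar g h θ)) (Ioc 0 (2 * Real.pi)))
    (hode : WeakDerivPer (fun θ => mulV (a (gradPolar g h θ)) (et θ))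
      (fun θ => -mulV (a (gradPolar g h θ)) (er θ))) :
    ∃ (N : Set ℝ) (K : ℝ), (∀ᵐ θ : ℝ, θ ∈ N) ∧ ∀ s ∈ N, ∀ t ∈ N, ‖h s - h t‖ ≤ K * |s - t| := by
  have hgp : Function.Periodic (fun θ => g (circ θ)) (2 * Real.pi) := fun θ => by
    simp only [circ_periodic θ]
  have hGp : Function.Periodic (gradPolar g h) (2 * Real.pi) := fun θ => by
    simp only [gradPolar, circ_periodic θ, er_periodic θ, et_periodic θ, hp θ]
  have hwp : Function.Periodic (fun θ => mulV (a (gradPolar g h θ)) (et θ)) (2 * Real.pi) :=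
    fun θ => by simp only [hGp θ, et_periodic θ]
  have hwp₁ : Function.Periodic (fun θ => -mulV (a (gradPolar g h θ)) (er θ)) (2 * Real.pi) :=
    fun θ => by simp only [hGp θ, er_periodic θ]
  have hb : ∀ {e : ℝ → Plane}, Continuous e → (∀ θ, ‖e θ‖ = 1) →
      IntegrableOn (fun θ => mulV (a (gradPolar g h θ)) (e θ)) (Ioc 0 (2 * Real.pi)) :=
    fun {e} he hn => by
      refine Integrable.mono' hai.norm ?_ (Filter.Eventually.of_forall fun θ => ?_)
      · exact continuous_mulV.comp_aestronglyMeasurable (hai.1.prodMk he.aestronglyMeasurable)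
      · simpa [hn] using norm_mulV_le (a (gradPolar g h θ)) (e θ)
  have hwi := hb continuous_et norm_et
  have hwi₁ : IntegrableOn (fun θ => -mulV (a (gradPolar g h θ)) (er θ)) (Ioc 0 (2 * Real.pi)) :=
    (hb continuous_er norm_er).neg
  have hme : ∀ (F : Mat m) (θ : ℝ), ‖mulV F (et θ)‖ ≤ ‖F‖ := fun F θ => by
    simpa [norm_et] using norm_mulV_le F (et θ)
  have hmr : ∀ (F : Mat m) (θ : ℝ), ‖mulV F (er θ)‖ ≤ ‖F‖ := fun F θ => by
    simpa [norm_er] using norm_mulV_le F (er θ)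
  have hade : ∀ (p : Vec m) (θ : ℝ), ‖dyad p (et θ)‖ = ‖p‖ := fun p θ => by
    rw [norm_dyad, norm_et, mul_one]
  have hadr : ∀ (p : Vec m) (θ : ℝ), ‖dyad p (er θ)‖ = ‖p‖ := fun p θ => by
    rw [norm_dyad, norm_er, mul_one]
  have habound : ∀ {ρ : ℝ} {F : Mat m}, ‖F‖ ≤ ρ → ‖a F‖ ≤ ‖a 0‖ + C * (1 + ρ) * ρ :=
    fun {ρ F} hF => by
      have h0 : 0 ≤ ρ := (norm_nonneg F).trans hF
      have h1 := hlip hF (G := 0) (by simpa using h0)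
      rw [sub_zero] at h1
      have h2 := norm_le_norm_add_norm_sub' (a F) (a 0)
      have h3 : C * (1 + ρ) * ‖F‖ ≤ C * (1 + ρ) * ρ := by gcongr
      linarith
  -- cancelling `‖p‖` in a quadratic lower bound
  have hcancel : ∀ {p q : Vec m} {M : ℝ}, ν * ‖p‖ ^ 2 ≤ inner ℝ q p → ‖q‖ ≤ M →
      ‖p‖ ≤ M / ν := fun {p q M} h1 h2 => by
    rw [le_div_iff₀ hν]
    rcases (norm_nonneg p).eq_or_lt with h0 | h0
    · rw [← h0, zero_mul]
      exact (norm_nonneg q).trans h2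
    · have h3 := h1.trans (real_inner_le_norm q p)
      have h4 : ‖q‖ * ‖p‖ ≤ M * ‖p‖ := by gcongr
      exact le_of_mul_le_mul_right (by linarith [h3.trans h4, pow_two ‖p‖]) h0
  obtain ⟨K₁, hK₁⟩ := hw.exists_ae_bound hgp hp hgi hi
  obtain ⟨K₂, hK₂⟩ := hode.exists_ae_bound hwp hwp₁ hwi hwi₁
  -- boundedness of `h`: compare the gradient with its radial part `g ⊗ e_r`
  set K₄ : ℝ := (K₂ + (‖a 0‖ + C * (1 + K₁) * K₁)) / ν with hK₄d
  have hK₄ : ∀ᵐ θ : ℝ, ‖h θ‖ ≤ K₄ := by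
    filter_upwards [hK₁, hK₂] with θ h1 h2
    have h3 := hmono (dyad (g (circ θ)) (er θ)) (h θ) (norm_et θ)
    refine hcancel h3 ((norm_sub_le _ _).trans (add_le_add h2 ?_))
    exact (hme _ _).trans (habound ((hadr _ _).trans_le h1))
  set ρ : ℝ := K₁ + K₄ with hρ
  set K₅ : ℝ := ‖a 0‖ + C * (1 + ρ) * ρ with hK₅d
  have hG : ∀ᵐ θ : ℝ, ‖gradPolar g h θ‖ ≤ ρ := by
    filter_upwards [hK₁, hK₄] with θ h1 h2
    refine (norm_add_le _ _).trans (add_le_add ?_ ?_)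
    · rwa [hadr]
    · rwa [hade]
  have hw₁b : ∀ᵐ θ : ℝ, ‖-mulV (a (gradPolar g h θ)) (er θ)‖ ≤ K₅ := by
    filter_upwards [hG] with θ h1
    rw [norm_neg]
    exact (hmr _ _).trans (habound h1)
  obtain ⟨N₁, hN₁, hg_lip⟩ := hw.exists_lipschitz hgp hp hgi hi hK₄
  obtain ⟨N₂, hN₂, hw_lip⟩ := hode.exists_lipschitz hwp hwp₁ hwi hwi₁ hw₁b
  refine ⟨{θ | (θ ∈ N₁ ∧ θ ∈ N₂) ∧ (‖g (circ θ)‖ ≤ K₁ ∧ ‖h θ‖ ≤ K₄)},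
    (K₅ + (C * (1 + ρ) * (K₄ + K₁ + K₄) + K₅)) / ν,
    (hN₁.and hN₂).and (hK₁.and hK₄), ?_⟩
  rintro s ⟨⟨hs1, hs2⟩, hs3, hs4⟩ t ⟨⟨ht1, ht2⟩, ht3, ht4⟩
  have hK₁0 := (norm_nonneg _).trans hs3
  have hK₄0 := (norm_nonneg _).trans hs4
  have hρ0 : 0 ≤ ρ := by positivity
  -- compare at `s` the two gradients with angular parts `h s` and `h t`
  set F : Mat m := dyad (g (circ s)) (er s) + dyad (h t) (et s) with hF
  have hFs : F + dyad (h s - h t) (et s) = gradPolar g h s := by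
    rw [hF, gradPolar, dyad_sub_left]
    abel
  have hFρ : ‖F‖ ≤ ρ := by
    refine (norm_add_le _ _).trans (add_le_add ?_ ?_)
    · rwa [hadr]
    · rwa [hade]
  have hGt : ‖gradPolar g h t‖ ≤ ρ := by
    refine (norm_add_le _ _).trans (add_le_add ?_ ?_)
    · rwa [hadr]
    · rwa [hade]
  have hFG : ‖F - gradPolar g h t‖ ≤ (K₄ + K₁ + K₄) * |s - t| := by
    have e : F - gradPolar g h t = dyad (g (circ s) - g (circ t)) (er s)
        + dyad (g (circ t)) (er s - er t) + dyad (h t) (et s - et t) := by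
      rw [hF, gradPolar, dyad_sub_left, dyad_sub_right, dyad_sub_right]
      abel
    rw [e, add_mul, add_mul]
    refine (norm_add_le _ _).trans (add_le_add ((norm_add_le _ _).trans (add_le_add ?_ ?_)) ?_)
    · rw [hadr]
      exact hg_lip s hs1 t ht1
    · rw [norm_dyad]
      exact mul_le_mul ht3 (norm_er_sub_le s t) (norm_nonneg _) hK₁0
    · rw [norm_dyad]
      exact mul_le_mul ht4 (norm_et_sub_le s t) (norm_nonneg _) hK₄0
  have h1 := hmono F (h s - h t) (norm_et s)
  rw [hFs] at h1
  rw [div_mul_eq_mul_div]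
  refine hcancel h1 ?_
  have e : mulV (a (gradPolar g h s)) (et s) - mulV (a F) (et s)
      = (mulV (a (gradPolar g h s)) (et s) - mulV (a (gradPolar g h t)) (et t))
        - (mulV (a F - a (gradPolar g h t)) (et s)
          + mulV (a (gradPolar g h t)) (et s - et t)) := by
    rw [mulV_sub, mulV_sub_right]
    abel
  rw [e, add_mul K₅, add_mul (C * (1 + ρ) * (K₄ + K₁ + K₄))]
  refine (norm_sub_le _ _).trans (add_le_add (hw_lip s hs2 t ht2)
    ((norm_add_le _ _).trans (add_le_add ?_ ?_)))
  · refine (hme _ _).trans ((hlip hFρ hGt).trans ?_)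
    rw [mul_assoc (C * (1 + ρ))]
    exact mul_le_mul_of_nonneg_left hFG (by positivity)
  · refine (norm_mulV_le _ _).trans (mul_le_mul (habound hGt) (norm_et_sub_le s t)
      (norm_nonneg _) ?_)
    exact (norm_nonneg _).trans (habound hGt)

/-- A periodic function of the angle descends to the circle. -/
lemma apply_angle_circ {α : Type*} {f : ℝ → α} (hf : Function.Periodic f (2 * Real.pi)) (θ : ℝ) :
    f (angle (circ θ : Plane)) = f θ := by
  have h := angle_polar (p := (1, θ)) one_pos hf
  simpa [polar, circ_coe] using h

end

end OneHom

end

theorem lemma1 (m : ℕ) (Ω : Set OneHom.Plane) (hΩ : IsOpen Ω) (h0 : (0 : OneHom.Plane) ∈ Ω)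
    (A : OneHom.Plane → OneHom.Mat m → OneHom.Mat m)
    (hA : ContDiffOn ℝ 1
      (fun z : OneHom.Plane × OneHom.Mat m => A z.1 z.2) (Ω ×ˢ (Set.univ : Set (OneHom.Mat m))))
    (C ν : ℝ) (hC : 0 < C) (hν : 0 < ν)
    (hgrowth : ∀ x ∈ Ω, ∀ F : OneHom.Mat m, ‖fderiv ℝ (A x) F‖ ≤ C * (1 + ‖F‖))
    (hell : ∀ x ∈ Ω, ∀ (F : OneHom.Mat m) (a : OneHom.Vec m) (b : OneHom.Plane),
      ν * ‖a‖ ^ 2 * ‖b‖ ^ 2 ≤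
        inner ℝ (fderiv ℝ (A x) F (OneHom.dyad a b)) (OneHom.dyad a b))
    (g : OneHom.S1 → OneHom.Vec m) (Du : OneHom.Plane → OneHom.Mat m)
    (hu : OneHom.IsW12 Ω (OneHom.oneHom g) Du)
    (hsol : ∀ φ : OneHom.Plane → OneHom.Vec m,
      ContDiff ℝ 1 φ → HasCompactSupport φ → tsupport φ ⊆ Ω →
        ∫ x in Ω, inner ℝ (A x (Du x)) (OneHom.gradMat φ x) = 0) :
    OneHom.MemW22S1 g := by
  open OneHom in
  obtain ⟨R, hR, hRΩ⟩ := Metric.nhds_basis_closedBall.mem_iff.1 (hΩ.mem_nhds h0)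
  have hbΩ : Metric.ball 0 R ⊆ Ω := Metric.ball_subset_closedBall.trans hRΩ
  obtain ⟨D, H, hD⟩ := hu.exists_isLocalGrad hΩ hR hbΩ
  obtain ⟨h, hm, hp, hi, hw⟩ := H.exists_weakDeriv
  have hB := continuous_coeff_retract hA hR hRΩ
  obtain ⟨K, hK⟩ := exists_bound_coeff_retract hΩ hA hC hgrowth hR hRΩ
  have hgi := H.integrableOn_circle
  have hG2 := H.integrableOn_sq_gradPolar hm hp hi hw
  have hGm : AEStronglyMeasurable (gradPolar g h) (volume.restrict (Ioc 0 (2 * Real.pi))) :=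
    (continuous_dyad.comp_aestronglyMeasurable
      (hgi.1.prodMk continuous_er.aestronglyMeasurable)).add
    (continuous_dyad.comp_aestronglyMeasurable (hi.1.prodMk continuous_et.aestronglyMeasurable))
  have hode := weakDerivPer_of_divergence_free hB hK hR hGm hG2 (H.ae_eq_gradPolar hm hp hi hw)
    fun ψ hψ c s => divergence_free_of_weak_solution hΩ hsol hB hK hbΩ
      (fun x hx F => by rw [retract_of_mem hR (mem_ball_zero_iff.1 hx).le]) H.meas H.sq hD hψ c s
  have hr0 : retract R 0 = 0 := retract_of_mem hR (by simpa using hR.le)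
  have hK0 : ∀ F, ‖A 0 F‖ ≤ K * (1 + ‖F‖ ^ 2) := fun F => by simpa [hr0] using hK 0 F
  rw [hr0] at hode
  have ha := contDiff_coeff hΩ hA h0
  have hai : IntegrableOn (fun θ => A 0 (gradPolar g h θ)) (Ioc 0 (2 * Real.pi)) :=
    Integrable.mono' (((integrable_const 1).add hG2).const_mul K)
      (ha.continuous.comp_aestronglyMeasurable hGm) (Filter.Eventually.of_forall fun θ => hK0 _)
  obtain ⟨N, L, hN, hlip⟩ := exists_lipschitz_derivative hC hν
    (fun hF hG => norm_sub_le_of_growth ha hC.le (hgrowth 0 h0) hF hG)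
    (fun F p _ hb => rankOne_monotone ha (hell 0 h0) F p hb) hp hgi hi hw hai hode
  obtain ⟨f, M, hf, hfp, hhf⟩ := exists_lipschitz_representative hp hN hlip
  have hdp : Function.Periodic (deriv f) (2 * Real.pi) := fun θ => by
    rw [← deriv_comp_add_const, show (fun x => f (x + 2 * Real.pi)) = f from funext hfp]
  have hf1 : (fun θ => f (angle (circ θ : Plane))) = f := funext (apply_angle_circ hfp)
  have hf2 : (fun θ => deriv f (angle (circ θ : Plane))) = deriv f :=
    funext (apply_angle_circ hdp)
  refine ⟨fun s => f (angle s), fun s => deriv f (angle s), ?_, ?_, ?_, ?_, ?_⟩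
  · obtain ⟨K', hK'⟩ := hw.exists_ae_bound (fun θ => by simp only [circ_periodic θ]) hp hgi hi
    exact MemLp.of_bound hgi.1 K' (ae_restrict_of_ae hK')
  · rw [MemL2S1, hf1]
    obtain ⟨K', hK'⟩ := (isCompact_Icc (a := (0 : ℝ)) (b := 2 * Real.pi)).exists_bound_of_continuousOn
      hf.continuous.continuousOn
    refine MemLp.of_bound hf.continuous.aestronglyMeasurable K' ?_
    filter_upwards [ae_restrict_mem measurableSet_Ioc] with θ hθ
    exact hK' θ (Ioc_subset_Icc_self hθ)
  · rw [MemL2S1, hf2]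
    exact MemLp.of_bound (stronglyMeasurable_deriv f).aestronglyMeasurable M
      (Filter.Eventually.of_forall fun θ => norm_deriv_le_of_lipschitz hf)
  · intro ψ hψ hψp
    simp only [apply_angle_circ hfp]
    rw [hw ψ hψ hψp]
    refine congrArg Neg.neg (integral_congr_ae ?_)
    filter_upwards [ae_restrict_of_ae hhf] with θ hθ
    rw [hθ]
  · intro ψ hψ hψp
    simp only [apply_angle_circ hfp, apply_angle_circ hdp]
    exact weakDerivPer_of_lipschitz hf hfp ψ hψ hψp
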